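/- Arithmetic operations are counted in the (non-uniform) arithmetic circuit model over $\mathbb{C}$: a circuit performs additions, subtractions and multiplications of two complex numbers, each argument being a constant, an input, or the result of an earlier operation, and its cost is the number of operations. Let $\omega$ be the exponent of matrix multiplication over $\mathbb{C}$, i.e. the infimum of the real numbers $\alpha$ such that $n\times n$ matrices can be multiplied with $O(n^{\alpha})$ operations. For a finite group $G$ let $\mathrm{Irr}(G)$ be a complete set of irreducible complex representations of $G$, i.e. one irreducible matrix representation (in an arbitrary basis) from each equivalence class. The $G$-DFT with respect to $\mathrm{Irr}(G)$ is the linear map taking the coefficients $(c_g)_{g\in G}$ of an element of $\mathbb{C}[G]$ to the entries of \[\bigoplus_{\rho\in\mathrm{Irr}(G)}\ \sum_{g\in G}c_g\,\rho(g).\] **Theorem.** For every $\epsilon>0$ there is a constant $c_\epsilon$ such that every finite solvable group $G$ has a complete set $\mathrm{Irr}(G)$ of irreducible complex representations, and for every such set the $G$-DFT with respect to $\mathrm{Irr}(G)$ can be computed with at most $c_\epsilon\,|G|^{\omega/2+\epsilon}$ operations. -/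

import Mathlib

/-! ### Arithmetic circuits and their operation count -/

/-- The three arithmetic operations that a gate may perform. -/
inductive ArithOp : Type
  | add
  | sub
  | mul

/-- The function computed by a gate. -/
def ArithOp.apply : ArithOp → ℂ → ℂ → ℂ
  | .add, a, b => a + b
  | .sub, a, b => a - b
  | .mul, a, b => a * b

/-- What a gate may read, and what may serve as an output, when the input variables are indexed by
`ι` and `s` gates precede it: a constant of `ℂ`, an input variable, or the result of one of the `s`
gates. -/
inductive Wire (ι : Type*) (s : ℕ) : Type _
  | const (z : ℂ) : Wire ι s
  | input (i : ι) : Wire ι s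
  | gate (j : Fin s) : Wire ι s

/-- The value on a wire, given the values `x` of the input variables and the results `v` of the
preceding gates. -/
def Wire.val {ι : Type*} {s : ℕ} (x : ι → ℂ) (v : Fin s → ℂ) : Wire ι s → ℂ
  | .const z => z
  | .input i => x i
  | .gate j => v j

/-- An arithmetic circuit over `ℂ` with inputs indexed by `ι` and exactly `s` gates, written as a
straight-line program: each gate applies one operation to two wires. -/
inductive ArithCircuit (ι : Type*) : ℕ → Type _
  | nil : ArithCircuit ι 0
  | snoc {s : ℕ} (C : ArithCircuit ι s) (op : ArithOp) (a b : Wire ι s) : ArithCircuit ι (s + 1)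

/-- The results of all gates of a circuit on the input `x`. -/
def ArithCircuit.eval {ι : Type*} (x : ι → ℂ) : {s : ℕ} → ArithCircuit ι s → Fin s → ℂ
  | _, .nil => Fin.elim0
  | _, .snoc C op a b =>
      Fin.snoc (α := fun _ => ℂ) (C.eval x) (op.apply (a.val x (C.eval x)) (b.val x (C.eval x)))

/-- The map `F` from families indexed by `ι` to families indexed by `κ` can be computed by an
arithmetic circuit with exactly `s` operations; every output is read off a wire. -/
def ComputableWith {ι κ : Type*} (F : (ι → ℂ) → (κ → ℂ)) (s : ℕ) : Prop :=
  ∃ (C : ArithCircuit ι s) (out : κ → Wire ι s), ∀ x k, (out k).val x (C.eval x) = F x k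

/-! ### The exponent of matrix multiplication -/

/-- Multiplication of two `n × n` matrices, as a map from the `2n²` entries of the factors to the
`n²` entries of the product. -/
def matMul (n : ℕ) (x : (Fin n × Fin n) ⊕ (Fin n × Fin n) → ℂ) : Fin n × Fin n → ℂ :=
  fun p => ∑ k, x (Sum.inl (p.1, k)) * x (Sum.inr (k, p.2))

/-- The exponent `ω` of matrix multiplication over `ℂ`: the infimum of all real `α` such that
`n × n` matrices can be multiplied with `O(n ^ α)` operations. -/
noncomputable def matMulExponent : ℝ :=
  sInf {α : ℝ | ∃ b : ℝ, ∀ n : ℕ, ∃ s : ℕ, (s : ℝ) ≤ b * (n : ℝ) ^ α ∧ ComputableWith (matMul n) s}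

/-! ### Irreducible matrix representations and the generalized DFT -/

/-- A matrix representation of `G`, viewed as a representation on column vectors. -/
noncomputable def matRep {G : Type*} [Group G] {d : ℕ} (ρ : G →* Matrix (Fin d) (Fin d) ℂ) :
    Representation ℂ G (Fin d → ℂ) :=
  (Matrix.toLinAlgEquiv' : Matrix (Fin d) (Fin d) ℂ ≃ₐ[ℂ] _).toAlgHom.toMonoidHom.comp ρ

/-- A complete set of irreducible complex representations of `G`: pairwise inequivalent irreducible
matrix representations (in arbitrary bases), one in each equivalence class. -/
structure CompleteIrreps (G : Type*) [Group G] where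
  /-- the number of representations -/
  num : ℕ
  /-- their dimensions -/
  dim : Fin num → ℕ
  /-- the representations -/
  rep : ∀ i, G →* Matrix (Fin (dim i)) (Fin (dim i)) ℂ
  irreducible : ∀ i, (matRep (rep i)).IsIrreducible
  inequivalent : ∀ i j, i ≠ j → IsEmpty ((matRep (rep i)).Equiv (matRep (rep j)))
  complete : ∀ (d : ℕ) (σ : G →* Matrix (Fin d) (Fin d) ℂ), (matRep σ).IsIrreducible →
    ∃ i, Nonempty ((matRep σ).Equiv (matRep (rep i)))

/-- The generalized DFT of `G` with respect to a complete set of irreducible representations: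
it maps the coefficients `c` of an element of `ℂ[G]` to the entries of all the matrices
`∑ g, c g • ρ g`, where `ρ` ranges over the given representations. -/
noncomputable def CompleteIrreps.dft {G : Type*} [Group G] [Fintype G] (I : CompleteIrreps G)
    (c : G → ℂ) : (Σ i : Fin I.num, Fin (I.dim i) × Fin (I.dim i)) → ℂ :=
  fun p => (∑ g, c g • I.rep p.1 g) p.2.1 p.2.2

/-!
The transform of a finite solvable group `G` is reduced to that of a normal subgroup `H` of prime
index `p`, with overhead `O(|G| ^ γ)` for `γ = ω / 2 + ε > 1`. Here `H` is the kernel of a character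
`χ` of order `p`, and `t` is an element for which `χ t` is a primitive `p`-th root of unity. Write
`c_l` for the restriction of the input `c` to the coset `H * t ^ l`, shifted to `H`. Then
`ρ(c) = ∑ l, ρ(c_l) * ρ(t) ^ l` for every representation `ρ` of `G`, so `p` transforms of `H`
supply all the matrices `σ(c_l)` with `σ` in `Irr(H)`. What remains is to combine them cheaply.

* If `ρ` stays irreducible on `H`, it is one of the `p` extensions of some `σ` in `Irr(H)`, and these
  differ by powers of `χ` (`exists_eq_smul_of_extension`). After `p` multiplications of matrices of
  the size of `σ`, the values of all `p` extensions are read off from a Fourier transform of length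
  `p` for each matrix entry (`computableWith_extensionDft`). These short transforms are done in
  `O(p ^ γ)` operations by Bluestein's method and the radix-2 fast Fourier transform
  (`exists_fourier_cost`).
* Otherwise `ρ` is made of `p × p` blocks of equal size on which `H` acts diagonally and which `t`
  permutes cyclically (`exists_block_decomposition`), so each of the `p ^ 2` blocks of `ρ(c)` comes
  from a single `c_l` and costs two multiplications of matrices of the size of a block
  (`exists_computableWith_of_not_irreducible`).

In both cases an arbitrary basis of `ρ` costs two more matrix multiplications. As matrices of size
`d` are multiplied in `O(d ^ (2 * γ))` operations and `∑ d ^ 2 ≤ |G|` by Schur orthogonality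
(`sum_sq_dim_le`), the overhead is `O(|G| ^ γ)`. Since `ω ≥ 2`, by counting the outputs of a matrix
multiplication, `γ > 1`, and the recursion `T(G) ≤ p * T(H) + O(|G| ^ γ)` gives
`T(G) = O(|G| ^ γ)` (`exists_dft_cost`).
-/

/-! ### Building circuits -/

namespace Wire

/-- The wires of a circuit seen in a longer one, after its inputs have been replaced by the wires
`out` of a circuit that runs before it. -/
def subst {ι κ : Type*} {s t : ℕ} (out : κ → Wire ι s) : Wire κ t → Wire ι (s + t)
  | .const z => .const z
  | .input k =>
    match out k with
    | .const z => .const z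
    | .input i => .input i
    | .gate j => .gate (Fin.castAdd t j)
  | .gate j => .gate (Fin.natAdd s j)

theorem val_subst {ι κ : Type*} {s t : ℕ} (out : κ → Wire ι s) (w : Wire κ t) (x : ι → ℂ)
    (u : Fin s → ℂ) (v : Fin t → ℂ) :
    (subst out w).val x (Fin.append u v) = w.val (fun k => (out k).val x u) v := by
  cases w with
  | const z => rfl
  | input k =>
    simp only [subst]
    cases h : out k <;> simp [val, h]
  | gate j => simp [subst, val]

end Wire

/-- Sequential composition of circuits: the second one reads the wires `out` of the first. -/
def ArithCircuit.append {ι κ : Type*} {s : ℕ} (C : ArithCircuit ι s) (out : κ → Wire ι s) :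
    {t : ℕ} → ArithCircuit κ t → ArithCircuit ι (s + t)
  | _, .nil => C
  | _, .snoc D op a b => .snoc (C.append out D) op (a.subst out) (b.subst out)

theorem ArithCircuit.eval_append {ι κ : Type*} {s t : ℕ} (C : ArithCircuit ι s)
    (out : κ → Wire ι s) (D : ArithCircuit κ t) (x : ι → ℂ) :
    (C.append out D).eval x =
      Fin.append (C.eval x) (D.eval fun k => (out k).val x (C.eval x)) := by
  induction D with
  | nil => ext i; simp [append, eval, Fin.append_right_nil]
  | @snoc t D op a b ih =>
    simp only [append, eval, ih, Wire.val_subst]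
    ext i
    refine Fin.lastCases ?_ (fun i => ?_) i
    · rw [Fin.snoc_last]
      refine .symm ((Fin.append_right _ _ (Fin.last t)).trans ?_)
      rw [Fin.snoc_last]
    · rw [Fin.snoc_castSucc]
      refine Fin.addCases (fun i => ?_) (fun i => ?_) i
      · exact (Fin.append_left _ _ i).trans (Fin.append_left _ _ i).symm
      · refine (Fin.append_right _ _ i).trans (.symm ((Fin.append_right _ _ i.castSucc).trans ?_))
        rw [Fin.snoc_castSucc]

namespace ComputableWith

variable {ι κ l : Type*}

theorem comp {F : (ι → ℂ) → κ → ℂ} {G : (κ → ℂ) → l → ℂ} {s t : ℕ}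
    (hF : ComputableWith F s) (hG : ComputableWith G t) :
    ComputableWith (fun x => G (F x)) (s + t) := by
  obtain ⟨C, out, hC⟩ := hF
  obtain ⟨D, out', hD⟩ := hG
  refine ⟨C.append out D, fun k => (out' k).subst out, fun x k => ?_⟩
  rw [ArithCircuit.eval_append, Wire.val_subst, hD]
  simp only [hC]

theorem wires (w : κ → Wire ι 0) :
    ComputableWith (fun x k => (w k).val x Fin.elim0) 0 :=
  ⟨.nil, w, fun _ _ => rfl⟩

theorem proj (f : κ → ι) : ComputableWith (fun (x : ι → ℂ) k => x (f k)) 0 :=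
  wires fun k => .input (f k)

theorem const (z : κ → ℂ) : ComputableWith (fun (_ : ι → ℂ) k => z k) 0 :=
  wires fun k => .const (z k)

theorem select {F : (ι → ℂ) → κ → ℂ} {s : ℕ} (hF : ComputableWith F s) (f : l → κ) :
    ComputableWith (fun x k => F x (f k)) s := by
  obtain ⟨C, out, hC⟩ := hF
  exact ⟨C, fun k => out (f k), fun x k => hC x (f k)⟩

theorem precomp {F : (ι → ℂ) → κ → ℂ} {s : ℕ} (hF : ComputableWith F s) (f : ι → l) :
    ComputableWith (fun (x : l → ℂ) => F fun i => x (f i)) s := by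
  simpa using (proj f).comp hF

/-- The inputs remain available as outputs. -/
theorem keep {F : (ι → ℂ) → κ → ℂ} {s : ℕ} (hF : ComputableWith F s) :
    ComputableWith (fun x => Sum.elim x (F x)) s := by
  obtain ⟨C, out, hC⟩ := hF
  refine ⟨C, Sum.elim .input out, fun x k => ?_⟩
  cases k with
  | inl i => rfl
  | inr k => exact hC x k

/-- Computing on the inputs together with values that have been computed before. -/
theorem comp_keep {F : (ι → ℂ) → κ → ℂ} {G : (ι ⊕ κ → ℂ) → l → ℂ} {s t : ℕ}
    (hF : ComputableWith F s) (hG : ComputableWith G t) :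
    ComputableWith (fun x => G (Sum.elim x (F x))) (s + t) :=
  hF.keep.comp hG

theorem pair {F : (ι → ℂ) → κ → ℂ} {G : (ι → ℂ) → l → ℂ} {s t : ℕ}
    (hF : ComputableWith F s) (hG : ComputableWith G t) :
    ComputableWith (fun x => Sum.elim (F x) (G x)) (s + t) := by
  have h := (hF.comp_keep (hG.precomp (Sum.inl : ι → ι ⊕ κ)).keep).select
    (Sum.elim (fun k => Sum.inl (Sum.inr k)) Sum.inr : κ ⊕ l → (ι ⊕ κ) ⊕ l)
  convert h using 3 with x k
  cases k <;> rfl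

theorem mono {F : (ι → ℂ) → κ → ℂ} {s t : ℕ} (hF : ComputableWith F s) (hst : s ≤ t) :
    ComputableWith F t := by
  obtain ⟨r, rfl⟩ := Nat.exists_eq_add_of_le hst
  have hpad : ∀ r, ∃ C : ArithCircuit κ r, True := by
    intro r
    induction r with
    | zero => exact ⟨.nil, trivial⟩
    | succ r ih => exact ⟨.snoc ih.choose .add (.const 0) (.const 0), trivial⟩
  exact hF.comp (G := fun y => y) ⟨(hpad r).choose, .input, fun _ _ => rfl⟩

/-- Independent computations on the same inputs, indexed by a finite type. -/
theorem sigma {I : Type*} [Fintype I] {κ : I → Type*} {F : ∀ i, (ι → ℂ) → κ i → ℂ} {s : I → ℕ}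
    (hF : ∀ i, ComputableWith (F i) (s i)) :
    ComputableWith (fun x (p : Σ i, κ i) => F p.1 x p.2) (∑ i, s i) := by
  classical
  have key : ∀ S : Finset I, ∃ F' : (ι → ℂ) → (Σ i, κ i) → ℂ,
      ComputableWith F' (∑ i ∈ S, s i) ∧ ∀ x, ∀ i ∈ S, ∀ k, F' x ⟨i, k⟩ = F i x k := by
    intro S
    induction S using Finset.induction_on with
    | empty => exact ⟨_, const 0, by simp⟩
    | insert a S ha ih =>
      obtain ⟨F', h1, h2⟩ := ih
      rw [Finset.sum_insert ha, add_comm]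
      refine ⟨_, (h1.pair (hF a)).select
        (fun p : Σ i, κ i => if h : p.1 = a then Sum.inr (h ▸ p.2) else Sum.inl p), ?_⟩
      intro x i hi k
      by_cases h : i = a
      · subst h; simp
      · simp [h, h2 x i ((Finset.mem_insert.1 hi).resolve_left h)]
  obtain ⟨F', h1, h2⟩ := key Finset.univ
  convert h1 using 3 with x p
  exact (h2 x p.1 (Finset.mem_univ _) p.2).symm

/-- Independent computations on the same inputs, with outputs in a product. -/
theorem prod {I : Type*} [Fintype I] {F : I → (ι → ℂ) → κ → ℂ} {s : I → ℕ}
    (hF : ∀ i, ComputableWith (F i) (s i)) :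
    ComputableWith (fun x (p : I × κ) => F p.1 x p.2) (∑ i, s i) :=
  (sigma hF).select fun p : I × κ => ⟨p.1, p.2⟩

/-- A map is computed coordinate by coordinate. -/
theorem coords [Fintype κ] {F : (ι → ℂ) → κ → ℂ} {s : ℕ}
    (hF : ∀ k, ComputableWith (fun x (_ : Unit) => F x k) s) :
    ComputableWith F (Fintype.card κ * s) := by
  have h := (prod hF).select fun k : κ => (k, ())
  simpa using h

theorem op (o : ArithOp) {f g : (ι → ℂ) → ℂ} {s t : ℕ}
    (hf : ComputableWith (fun x (_ : Unit) => f x) s)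
    (hg : ComputableWith (fun x (_ : Unit) => g x) t) :
    ComputableWith (fun x (_ : Unit) => o.apply (f x) (g x)) (s + t + 1) := by
  have h : ComputableWith
      (fun (y : Unit ⊕ Unit → ℂ) (_ : Unit) => o.apply (y (Sum.inl ())) (y (Sum.inr ()))) 1 :=
    ⟨.snoc .nil o (.input (Sum.inl ())) (.input (Sum.inr ())), fun _ => .gate 0, fun x k => rfl⟩
  exact (hf.pair hg).comp h

theorem add {f g : (ι → ℂ) → ℂ} {s t : ℕ}
    (hf : ComputableWith (fun x (_ : Unit) => f x) s)
    (hg : ComputableWith (fun x (_ : Unit) => g x) t) :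
    ComputableWith (fun x (_ : Unit) => f x + g x) (s + t + 1) := op .add hf hg

theorem mul {f g : (ι → ℂ) → ℂ} {s t : ℕ}
    (hf : ComputableWith (fun x (_ : Unit) => f x) s)
    (hg : ComputableWith (fun x (_ : Unit) => g x) t) :
    ComputableWith (fun x (_ : Unit) => f x * g x) (s + t + 1) := op .mul hf hg

theorem input (i : ι) : ComputableWith (fun (x : ι → ℂ) (_ : Unit) => x i) 0 :=
  proj fun _ => i

theorem const_scalar (z : ℂ) : ComputableWith (fun (_ : ι → ℂ) (_ : Unit) => z) 0 :=
  const fun _ => z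

theorem sum {I : Type*} (S : Finset I) {f : I → (ι → ℂ) → ℂ} {s : ℕ}
    (hf : ∀ i, ComputableWith (fun x (_ : Unit) => f i x) s) :
    ComputableWith (fun x (_ : Unit) => ∑ i ∈ S, f i x) (S.card * (s + 1)) := by
  classical
  induction S using Finset.induction_on with
  | empty => simpa using const_scalar (0 : ℂ)
  | insert a S ha ih =>
    have h := (hf a).add ih
    simp only [Finset.sum_insert ha, Finset.card_insert_of_notMem ha]
    exact h.mono (by ring_nf; omega)

/-- Scaling every output by a constant. -/
theorem scale [Fintype κ] {F : (ι → ℂ) → κ → ℂ} {s : ℕ} (hF : ComputableWith F s) (a : κ → ℂ) :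
    ComputableWith (fun x k => a k * F x k) (s + Fintype.card κ) := by
  have h : ComputableWith (fun (y : κ → ℂ) k => a k * y k) (Fintype.card κ * 1) :=
    coords fun k => (const_scalar (a k)).mul (input k)
  rw [mul_one] at h
  exact hF.comp h

/-- A linear map given by a matrix, applied naively. -/
theorem linear [Fintype ι] [Fintype κ] (a : κ → ι → ℂ) :
    ComputableWith (fun x k => ∑ i, a k i * x i) (Fintype.card κ * (Fintype.card ι * 2)) :=
  coords fun k => sum Finset.univ fun i => (const_scalar (a k i)).mul (input i)

end ComputableWith

/-! ### Matrix multiplication and its exponent -/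

namespace ComputableWith

/-- Rectangular matrices whose index types have at most `N` elements are multiplied by padding them
with zeros to square matrices of size `N`. -/
theorem matrix_mul {N s : ℕ} (h : ComputableWith (matMul N) s) {m n k : Type*} [Fintype m]
    [Fintype n] [Fintype k] (hm : Fintype.card m ≤ N) (hn : Fintype.card n ≤ N)
    (hk : Fintype.card k ≤ N) :
    ComputableWith (fun (x : (m × n) ⊕ (n × k) → ℂ) (p : m × k) =>
      ∑ j, x (Sum.inl (p.1, j)) * x (Sum.inr (j, p.2))) s := by
  classical
  obtain ⟨em⟩ : Nonempty (m ↪ Fin N) := Function.Embedding.nonempty_of_card_le (by simpa using hm)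
  obtain ⟨en⟩ : Nonempty (n ↪ Fin N) := Function.Embedding.nonempty_of_card_le (by simpa using hn)
  obtain ⟨ek⟩ : Nonempty (k ↪ Fin N) := Function.Embedding.nonempty_of_card_le (by simpa using hk)
  let f : (m × n) ⊕ (n × k) → (Fin N × Fin N) ⊕ (Fin N × Fin N) :=
    Sum.map (Prod.map em en) (Prod.map en ek)
  have hf : Function.Injective f :=
    Sum.map_injective.2 ⟨em.injective.prodMap en.injective, en.injective.prodMap ek.injective⟩
  have h' := ((wires (Function.extend f (fun i => Wire.input (s := 0) i)
    (fun _ => Wire.const 0))).comp h).select (Prod.map em ek)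
  rw [zero_add] at h'
  convert h' using 3 with x p
  refine Fintype.sum_of_injective en en.injective _ _ ?_ ?_
  · intro i hi
    have : ¬ ∃ a, f a = Sum.inl (em p.1, i) := by
      rintro ⟨a | a, ha⟩
      · simp only [f, Sum.map_inl, Sum.inl.injEq, Prod.map_apply', Prod.mk.injEq] at ha
        exact hi ⟨_, ha.2⟩
      · simp [f] at ha
    simp [Function.extend_apply' _ _ _ this, Wire.val]
  · intro i
    have h1 : Sum.inl (em p.1, en i) = f (Sum.inl (p.1, i)) := rfl
    have h2 : Sum.inr (en i, ek p.2) = f (Sum.inr (i, p.2)) := rfl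
    simp only [Prod.map_fst, Prod.map_snd, h1, h2, hf.extend_apply, Wire.val]

variable {ι : Type*}

/-- Multiplying a matrix that has been computed by a constant matrix on the left. -/
theorem const_mul {N s r : ℕ} (h : ComputableWith (matMul N) r) {m n k : Type*} [Fintype m]
    [Fintype n] [Fintype k] (hm : Fintype.card m ≤ N) (hn : Fintype.card n ≤ N)
    (hk : Fintype.card k ≤ N) {Y : (ι → ℂ) → Matrix n k ℂ}
    (hY : ComputableWith (fun x (p : n × k) => Y x p.1 p.2) s) (A : Matrix m n ℂ) :
    ComputableWith (fun x (p : m × k) => (A * Y x) p.1 p.2) (s + r) := by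
  have h0 : ComputableWith (fun (_ : ι → ℂ) (p : m × n) => A p.1 p.2) 0 := const _
  have h1 := (h0.pair hY).comp (h.matrix_mul hm hn hk)
  rw [zero_add] at h1
  exact h1

/-- Multiplying a matrix that has been computed by a constant matrix on the right. -/
theorem mul_const {N s r : ℕ} (h : ComputableWith (matMul N) r) {m n k : Type*} [Fintype m]
    [Fintype n] [Fintype k] (hm : Fintype.card m ≤ N) (hn : Fintype.card n ≤ N)
    (hk : Fintype.card k ≤ N) {Y : (ι → ℂ) → Matrix m n ℂ}
    (hY : ComputableWith (fun x (p : m × n) => Y x p.1 p.2) s) (A : Matrix n k ℂ) :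
    ComputableWith (fun x (p : m × k) => (Y x * A) p.1 p.2) (s + r) := by
  have h0 : ComputableWith (fun (_ : ι → ℂ) (p : n × k) => A p.1 p.2) 0 := const _
  exact (hY.pair h0).comp (h.matrix_mul hm hn hk)

end ComputableWith

/-- The entries of a product of two matrices are pairwise distinct functions that are neither
constants nor inputs, so each of them is the result of a gate of its own. -/
theorem sq_le_of_computableWith_matMul {n s : ℕ} (h : ComputableWith (matMul n) s) :
    n ^ 2 ≤ s := by
  obtain ⟨C, out, hC⟩ := h
  have hgate : ∀ p : Fin n × Fin n, ∃ j, out p = .gate j := by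
    intro p
    have hn : (n : ℂ) ≠ 0 := by
      have := p.1.pos
      exact_mod_cast this.ne'
    have h0 := hC (fun _ => 0) p
    have h1 := hC (fun _ => 1) p
    have h2 := hC (fun _ => 2) p
    cases ho : out p with
    | const z =>
      simp only [ho, Wire.val, matMul] at h0 h1
      simp only [mul_zero, Finset.sum_const_zero] at h0
      simp [h0] at h1
      exact absurd h1.symm (by exact_mod_cast hn)
    | input i =>
      simp only [ho, Wire.val, matMul] at h1 h2
      simp at h1 h2
      rw [← h1] at h2
      norm_num at h2
    | gate j => exact ⟨j, rfl⟩
  choose g hg using hgate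
  have hinj : Function.Injective g := by
    intro p q hpq
    by_contra hne
    have e : ∀ x, matMul n x p = matMul n x q := fun x => by
      rw [← hC, ← hC, hg, hg, hpq]
    have := e (Sum.elim (fun r => if r = (p.1, p.1) then 1 else 0) fun r => if r = p then 1 else 0)
    have hp : matMul n (Sum.elim (fun r => if r = (p.1, p.1) then 1 else 0)
        fun r => if r = p then 1 else 0) p = 1 := by
      simp [matMul, Prod.ext_iff]
    rw [hp] at this
    have hq : matMul n (Sum.elim (fun r => if r = (p.1, p.1) then 1 else 0)
        fun r => if r = p then 1 else 0) q = 0 := by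
      refine Finset.sum_eq_zero fun k _ => ?_
      by_cases h1 : q.1 = p.1
      · have h2 : q.2 ≠ p.2 := fun h2 => hne (Prod.ext h1.symm h2.symm)
        simp [Prod.ext_iff, h2]
      · simp [Prod.ext_iff, h1]
    rw [hq] at this
    exact one_ne_zero this
  have := Fintype.card_le_of_injective g hinj
  simpa [sq] using this

/-- The exponents `α` such that `n × n` matrices can be multiplied with `O(n ^ α)` operations. -/
def matMulExponents : Set ℝ :=
  {α : ℝ | ∃ b : ℝ, ∀ n : ℕ, ∃ s : ℕ, (s : ℝ) ≤ b * (n : ℝ) ^ α ∧ ComputableWith (matMul n) s}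

theorem three_mem_matMulExponents : (3 : ℝ) ∈ matMulExponents := by
  refine ⟨2, fun n => ⟨n * n * (n * 2), ?_, ?_⟩⟩
  · have : (n : ℝ) ^ (3 : ℝ) = (n : ℝ) ^ 3 := by exact_mod_cast Real.rpow_natCast (n : ℝ) 3
    rw [this]; push_cast; exact le_of_eq (by ring)
  · have h : ComputableWith (matMul n) (Fintype.card (Fin n × Fin n) * (Finset.univ.card * 2)) :=
      ComputableWith.coords fun p => ComputableWith.sum (Finset.univ : Finset (Fin n)) fun k =>
        (ComputableWith.input (Sum.inl (p.1, k))).mul (ComputableWith.input (Sum.inr (k, p.2)))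
    simpa using h

theorem two_le_of_mem_matMulExponents {α : ℝ} (hα : α ∈ matMulExponents) : 2 ≤ α := by
  obtain ⟨b, hb⟩ := hα
  by_contra! hlt
  have ht := (tendsto_rpow_atTop (sub_pos.2 hlt)).comp tendsto_natCast_atTop_atTop
  obtain ⟨n, hn, hn1⟩ := ((ht.eventually_gt_atTop b).and (Filter.eventually_ge_atTop 1)).exists
  obtain ⟨s, hs, hc⟩ := hb n
  have hpos : (0 : ℝ) < n := by exact_mod_cast hn1
  have h2 : ((n ^ 2 : ℕ) : ℝ) ≤ s := by exact_mod_cast sq_le_of_computableWith_matMul hc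
  have h3 : (n : ℝ) ^ (2 - α) * (n : ℝ) ^ α = (n : ℝ) ^ 2 := by
    rw [← Real.rpow_add hpos]; norm_num
  have h4 : b * (n : ℝ) ^ α < (n : ℝ) ^ (2 - α) * (n : ℝ) ^ α :=
    mul_lt_mul_of_pos_right hn (Real.rpow_pos_of_pos hpos _)
  push_cast at h2
  linarith

theorem two_le_matMulExponent : 2 ≤ matMulExponent :=
  le_csInf ⟨3, three_mem_matMulExponents⟩ fun _ h => two_le_of_mem_matMulExponents h

theorem exists_matMul_cost {α : ℝ} (hα : matMulExponent < α) :
    ∃ b : ℝ, 0 ≤ b ∧ ∃ μ : ℕ → ℕ, ∀ n, 1 ≤ n →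
      ComputableWith (matMul n) (μ n) ∧ (μ n : ℝ) ≤ b * (n : ℝ) ^ α := by
  obtain ⟨a, ⟨b, hb⟩, ha⟩ := exists_lt_of_csInf_lt ⟨3, three_mem_matMulExponents⟩ hα
  choose μ h1 h2 using hb
  have hb0 : 0 ≤ b := by simpa using (Nat.cast_nonneg _).trans (h1 1)
  refine ⟨b, hb0, μ, fun n hn => ⟨h2 n, (h1 n).trans ?_⟩⟩
  exact mul_le_mul_of_nonneg_left
    (Real.rpow_le_rpow_of_exponent_le (by exact_mod_cast hn) ha.le) hb0

/-! ### Fast Fourier transforms of arbitrary length -/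

namespace ComputableWith

/-- One step of the radix-2 fast Fourier transform: the even and the odd part of the input are
transformed separately. -/
theorem fourier_double {N s : ℕ}
    (h : ∀ w : ℂ, w ^ N = 1 → ComputableWith
      (fun (x : Fin N → ℂ) (i : Fin N) => ∑ j : Fin N, w ^ ((i : ℕ) * j) * x j) s)
    (w : ℂ) (hw : w ^ (N * 2) = 1) :
    ComputableWith (fun (x : Fin (N * 2) → ℂ) (i : Fin (N * 2)) =>
      ∑ j : Fin (N * 2), w ^ ((i : ℕ) * j) * x j) (s + s + N * 2 * 2) := by
  have hw2 : (w ^ 2) ^ N = 1 := by rw [← pow_mul, mul_comm, hw]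
  have h0 := (h _ hw2).precomp fun j : Fin N => finProdFinEquiv (j, (0 : Fin 2))
  have h1 := (h _ hw2).precomp fun j : Fin N => finProdFinEquiv (j, (1 : Fin 2))
  have hN : ∀ i : Fin (N * 2), (i : ℕ) % N < N := fun i =>
    Nat.mod_lt _ (Nat.pos_of_ne_zero fun h => by have := i.isLt; omega)
  have h2 : ComputableWith (fun (y : Fin N ⊕ Fin N → ℂ) (i : Fin (N * 2)) =>
      y (Sum.inl ⟨i % N, hN i⟩) + w ^ (i : ℕ) * y (Sum.inr ⟨i % N, hN i⟩))
      (Fintype.card (Fin (N * 2)) * 2) :=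
    coords fun i => (input _).add ((const_scalar _).mul (input _))
  have h3 := (h0.pair h1).comp h2
  rw [Fintype.card_fin] at h3
  convert h3 using 3 with x i
  have hpow : ∀ a : ℕ, (w ^ 2) ^ ((i : ℕ) % N * a) = (w ^ 2) ^ ((i : ℕ) * a) := by
    intro a
    have h1 : ((w ^ 2) ^ a) ^ N = 1 := by rw [← pow_mul, mul_comm, pow_mul, hw2, one_pow]
    rw [mul_comm _ a, mul_comm _ a, pow_mul, pow_mul]
    exact (pow_eq_pow_mod (i : ℕ) h1).symm
  rw [← finProdFinEquiv.sum_comp, Fintype.sum_prod_type]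
  simp only [Fin.sum_univ_two, Finset.sum_add_distrib, Sum.elim_inl, Sum.elim_inr, hpow,
    Finset.mul_sum]
  congr 1
  · refine Finset.sum_congr rfl fun j _ => ?_
    congr 1
    rw [← pow_mul]; congr 1
    simp [finProdFinEquiv]; ring
  · refine Finset.sum_congr rfl fun j _ => ?_
    rw [← mul_assoc]
    congr 1
    rw [← pow_mul, ← pow_add]; congr 1
    simp [finProdFinEquiv]; ring

theorem fourier_two_pow (k : ℕ) : ∀ w : ℂ, w ^ (2 ^ k) = 1 → ComputableWith
    (fun (x : Fin (2 ^ k) → ℂ) (i : Fin (2 ^ k)) => ∑ j : Fin (2 ^ k), w ^ ((i : ℕ) * j) * x j)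
      (2 * k * 2 ^ k) := by
  induction k with
  | zero =>
    intro w hw
    refine cast ?_ (proj (fun i : Fin 1 => i))
    congr 1
    ext x i
    have := Subsingleton.elim i 0
    subst this
    simp
  | succ k ih =>
    intro w hw
    have h := fourier_double ih w hw
    rw [show 2 * (k + 1) * 2 ^ (k + 1) = 2 * k * 2 ^ k + 2 * k * 2 ^ k + 2 ^ k * 2 * 2 by ring]
    exact h

/-- A sequence of length `N` is a combination of the powers of the `N`-th roots of unity. -/
theorem exists_fourier_coeff {N : ℕ} {w : ℂ} (hw : IsPrimitiveRoot w N) (h : ℕ → ℂ) :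
    ∃ q : Fin N → ℂ, ∀ s < N, h s = ∑ i : Fin N, q i * w ^ ((i : ℕ) * s) := by
  have hdet : IsUnit (Matrix.vandermonde fun i : Fin N => w ^ (i : ℕ)).det :=
    isUnit_iff_ne_zero.2 <| Matrix.det_vandermonde_ne_zero_iff.2 fun i j hij =>
      Fin.ext (hw.pow_inj i.isLt j.isLt hij)
  refine ⟨Matrix.vecMul (fun i : Fin N => h i) (Matrix.vandermonde fun i : Fin N => w ^ (i : ℕ))⁻¹,
    fun s hs => ?_⟩
  have := congrFun (Matrix.vecMul_vecMul (fun i : Fin N => h i)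
    (Matrix.vandermonde fun i : Fin N => w ^ (i : ℕ))⁻¹
    (Matrix.vandermonde fun i : Fin N => w ^ (i : ℕ))) ⟨s, hs⟩
  rw [Matrix.nonsing_inv_mul _ hdet, Matrix.vecMul_one] at this
  rw [← this]
  simp [Matrix.vecMul, dotProduct, Matrix.vandermonde_apply, pow_mul]

/-- Multiplication by a fixed Hankel matrix, through two fast Fourier transforms. -/
theorem hankel {p m : ℕ} (hp : 2 * p ≤ 2 ^ m) (h : ℕ → ℂ) :
    ComputableWith (fun (x : Fin p → ℂ) (k : Fin p) => ∑ n : Fin p, h (n + k) * x n)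
      (4 * m * 2 ^ m + 2 ^ m) := by
  obtain ⟨w, hw⟩ : ∃ w : ℂ, IsPrimitiveRoot w (2 ^ m) :=
    ⟨_, Complex.isPrimitiveRoot_exp _ (by positivity)⟩
  obtain ⟨q, hq⟩ := exists_fourier_coeff hw h
  have hle : p ≤ 2 ^ m := by omega
  have hpad : ComputableWith (fun (x : Fin p → ℂ) (n : Fin (2 ^ m)) =>
      if h : (n : ℕ) < p then x ⟨n, h⟩ else 0) 0 := by
    convert wires (fun n : Fin (2 ^ m) =>
      if h : (n : ℕ) < p then Wire.input (s := 0) (⟨n, h⟩ : Fin p) else Wire.const 0) using 3 with x n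
    split_ifs <;> rfl
  have hF := fourier_two_pow m w hw.pow_eq_one
  have h1 := (((hpad.comp hF).scale q).comp hF).select fun k : Fin p => Fin.castLE hle k
  rw [Fintype.card_fin,
    show 0 + 2 * m * 2 ^ m + 2 ^ m + 2 * m * 2 ^ m = 4 * m * 2 ^ m + 2 ^ m by ring] at h1
  convert h1 using 3 with x k
  have hsum : ∀ i : Fin (2 ^ m), (∑ j : Fin (2 ^ m), w ^ ((i : ℕ) * j) *
      (if h : (j : ℕ) < p then x ⟨j, h⟩ else 0)) = ∑ n : Fin p, w ^ ((i : ℕ) * n) * x n := by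
    intro i
    symm
    refine Fintype.sum_of_injective (Fin.castLE hle) (Fin.castLE_injective hle) _ _ ?_ ?_
    · intro j hj
      rw [dif_neg, mul_zero]
      exact fun hlt => hj ⟨⟨j, hlt⟩, rfl⟩
    · intro n
      simp
  simp only [hsum]
  calc ∑ n : Fin p, h (n + k) * x n
      = ∑ n : Fin p, ∑ i : Fin (2 ^ m), w ^ ((k : ℕ) * i) * (q i * (w ^ ((i : ℕ) * n) * x n)) := by
        refine Finset.sum_congr rfl fun n _ => ?_
        rw [hq _ (by omega), Finset.sum_mul]
        refine Finset.sum_congr rfl fun i _ => ?_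
        rw [mul_add, pow_add, mul_comm (k : ℕ)]; ring
    _ = _ := by
        rw [Finset.sum_comm]
        simp only [Finset.mul_sum, Fin.val_castLE]

/-- Bluestein's reduction of a Fourier transform of arbitrary length to a Hankel matrix, by
`kl = (k + l).choose 2 - k.choose 2 - l.choose 2`. -/
theorem fourier {p m : ℕ} (hp : 2 * p ≤ 2 ^ m) {w : ℂ} (hw : w ≠ 0) :
    ComputableWith (fun (x : Fin p → ℂ) (k : Fin p) => ∑ l : Fin p, w ^ ((k : ℕ) * l) * x l)
      (4 * m * 2 ^ m + 2 ^ m + 2 * p) := by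
  have hchoose : ∀ k l : ℕ, (l + k).choose 2 = k.choose 2 + l.choose 2 + k * l := by
    intro k l
    induction l with
    | zero => simp
    | succ l ih =>
      rw [show l + 1 + k = (l + k) + 1 by ring, Nat.choose_succ_succ' (l + k) 1,
        Nat.choose_succ_succ' l 1, ih]
      simp; ring
  have hid : ComputableWith (fun (x : Fin p → ℂ) (k : Fin p) => x k) 0 := proj fun k => k
  have h := ((hid.scale fun l : Fin p => (w ^ (l : ℕ).choose 2)⁻¹).comp
    (hankel hp fun s => w ^ s.choose 2)).scale fun k : Fin p => (w ^ (k : ℕ).choose 2)⁻¹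
  rw [Fintype.card_fin, show 0 + p + (4 * m * 2 ^ m + 2 ^ m) + p = 4 * m * 2 ^ m + 2 ^ m + 2 * p by
    ring] at h
  convert h using 3 with x k
  rw [Finset.mul_sum]
  refine Finset.sum_congr rfl fun l _ => ?_
  rw [hchoose, pow_add, pow_add]
  have h1 : w ^ (k : ℕ).choose 2 ≠ 0 := pow_ne_zero _ hw
  have h2 : w ^ (l : ℕ).choose 2 ≠ 0 := pow_ne_zero _ hw
  field_simp

end ComputableWith

theorem exists_fourier_cost {γ : ℝ} (hγ : 1 < γ) :
    ∃ K : ℝ, 0 ≤ K ∧ ∃ φ : ℕ → ℕ, ∀ p, 1 ≤ p → (φ p : ℝ) ≤ K * (p : ℝ) ^ γ ∧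
      ∀ w : ℂ, w ≠ 0 → ComputableWith
        (fun (x : Fin p → ℂ) (k : Fin p) => ∑ l : Fin p, w ^ ((k : ℕ) * l) * x l) (φ p) := by
  have hδ : 0 < γ - 1 := by linarith
  have hl : 0 < Real.log 2 := Real.log_pos (by norm_num)
  refine ⟨(2 + 4 / ((γ - 1) * Real.log 2)) * 4 ^ γ, by positivity,
    fun p => 4 * (Nat.log 2 (2 * p) + 1) * 2 ^ (Nat.log 2 (2 * p) + 1) +
      2 ^ (Nat.log 2 (2 * p) + 1) + 2 * p, fun p hp => ?_⟩
  obtain ⟨m, hm⟩ : ∃ m, m = Nat.log 2 (2 * p) + 1 := ⟨_, rfl⟩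
  have h1 : 2 * p ≤ 2 ^ m := by
    rw [hm]; exact (Nat.lt_pow_succ_log_self (by norm_num) _).le
  have h2 : 2 ^ m ≤ 4 * p := by
    have := Nat.pow_log_le_self 2 (x := 2 * p) (by omega)
    rw [hm, pow_succ]; omega
  simp only [← hm]
  refine ⟨?_, fun w hw => ComputableWith.fourier h1 hw⟩
  obtain ⟨X, hX⟩ : ∃ X : ℝ, X = 2 ^ m := ⟨_, rfl⟩
  have hX1 : (1 : ℝ) ≤ X := by rw [hX]; exact one_le_pow₀ (by norm_num)
  have hX0 : 0 < X := by linarith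
  have hmX : (m : ℝ) ≤ 1 / ((γ - 1) * Real.log 2) * X ^ (γ - 1) := by
    have := Real.log_le_rpow_div hX0.le hδ
    rw [hX, Real.log_pow, ← hX] at this
    rw [div_mul_eq_mul_div, one_mul, le_div_iff₀ (by positivity)]
    rw [le_div_iff₀ hδ] at this
    linarith
  have hXγ : X ^ (γ - 1) * X = X ^ γ := by
    rw [← Real.rpow_add_one hX0.ne']; simp
  have hXle : X ≤ X ^ γ := by
    simpa using Real.rpow_le_rpow_of_exponent_le hX1 hγ.le
  have hX4 : X ^ γ ≤ 4 ^ γ * (p : ℝ) ^ γ := by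
    rw [← Real.mul_rpow (by norm_num) (by positivity)]
    refine Real.rpow_le_rpow hX0.le ?_ (by linarith)
    rw [hX]; exact_mod_cast h2
  have hpX : 2 * (p : ℝ) ≤ X := by rw [hX]; exact_mod_cast h1
  have hmX' : (m : ℝ) * X ≤ 1 / ((γ - 1) * Real.log 2) * X ^ γ := by
    rw [← hXγ, ← mul_assoc]; exact mul_le_mul_of_nonneg_right hmX hX0.le
  push_cast
  rw [← hX]
  calc 4 * (m : ℝ) * X + X + 2 * p ≤ 4 * (1 / ((γ - 1) * Real.log 2) * X ^ γ) + X ^ γ + X ^ γ := by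
        linarith
    _ = (2 + 4 / ((γ - 1) * Real.log 2)) * X ^ γ := by ring
    _ ≤ (2 + 4 / ((γ - 1) * Real.log 2)) * (4 ^ γ * (p : ℝ) ^ γ) := by gcongr
    _ = _ := by ring

/-! ### Irreducible matrix representations -/

section MatrixRepresentations

open Matrix

variable {G : Type*} [Group G] {d e : ℕ}

theorem matRep_apply (ρ : G →* Matrix (Fin d) (Fin d) ℂ) (g : G) (v : Fin d → ℂ) :
    matRep ρ g v = ρ g *ᵥ v := by
  simp [matRep, Matrix.toLinAlgEquiv'_apply]

theorem matRep_isIrreducible_iff (ρ : G →* Matrix (Fin d) (Fin d) ℂ) :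
    (matRep ρ).IsIrreducible ↔ 0 < d ∧ ∀ W : Submodule ℂ (Fin d → ℂ),
      (∀ g, ∀ v ∈ W, ρ g *ᵥ v ∈ W) → W = ⊥ ∨ W = ⊤ := by
  constructor
  · intro h
    refine ⟨?_, fun W hW => ?_⟩
    · rcases Nat.eq_zero_or_pos d with rfl | hd
      · exfalso
        have h1 : (⊥ : Subrepresentation (matRep ρ)) = ⊤ :=
          Subrepresentation.toSubmodule_injective (Subsingleton.elim _ _)
        exact h.bot_ne_top h1
      · exact hd
    · let S : Subrepresentation (matRep ρ) :=
        ⟨W, fun g v hv => by rw [matRep_apply]; exact hW g v hv⟩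
      rcases eq_bot_or_eq_top S with h1 | h1
      · exact .inl (congrArg Subrepresentation.toSubmodule h1)
      · exact .inr (congrArg Subrepresentation.toSubmodule h1)
  · rintro ⟨hd, h⟩
    have : Nonempty (Fin d) := ⟨⟨0, hd⟩⟩
    refine { exists_pair_ne := ⟨⊥, ⊤, fun h1 => ?_⟩, eq_bot_or_eq_top := fun S => ?_ }
    · exact bot_ne_top (α := Submodule ℂ (Fin d → ℂ))
        (congrArg Subrepresentation.toSubmodule h1)
    · rcases h S.toSubmodule
        (fun g v hv => by rw [← matRep_apply]; exact S.apply_mem_toSubmodule g hv) with h1 | h1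
      · exact .inl (Subrepresentation.toSubmodule_injective h1)
      · exact .inr (Subrepresentation.toSubmodule_injective h1)

/-- The intertwining map of matrix representations given by a matrix. -/
noncomputable def intertwiner {ρ : G →* Matrix (Fin d) (Fin d) ℂ}
    {σ : G →* Matrix (Fin e) (Fin e) ℂ} (A : Matrix (Fin d) (Fin e) ℂ)
    (hA : ∀ g, ρ g * A = A * σ g) : (matRep σ).IntertwiningMap (matRep ρ) where
  toLinearMap := A.mulVecLin
  isIntertwining' g := by
    refine LinearMap.ext fun v => ?_
    simp [matRep_apply, Matrix.mulVec_mulVec, hA]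

theorem intertwiner_apply {ρ : G →* Matrix (Fin d) (Fin d) ℂ}
    {σ : G →* Matrix (Fin e) (Fin e) ℂ} (A : Matrix (Fin d) (Fin e) ℂ)
    (hA : ∀ g, ρ g * A = A * σ g) (v : Fin e → ℂ) : intertwiner A hA v = A *ᵥ v := rfl

theorem matrix_eq_of_mulVec {m n : Type*} [Fintype n] [DecidableEq n] {A B : Matrix m n ℂ}
    (h : ∀ v, A *ᵥ v = B *ᵥ v) : A = B :=
  Matrix.toLin'.injective (LinearMap.ext fun v => by simpa using h v)

theorem exists_matrix_of_equiv {ρ : G →* Matrix (Fin d) (Fin d) ℂ}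
    {σ : G →* Matrix (Fin e) (Fin e) ℂ} (f : (matRep ρ).Equiv (matRep σ)) :
    ∃ (P : Matrix (Fin d) (Fin e) ℂ) (Q : Matrix (Fin e) (Fin d) ℂ), P * Q = 1 ∧ Q * P = 1 ∧
      ∀ g, ρ g = P * σ g * Q := by
  obtain ⟨e, he⟩ : ∃ e : (Fin d → ℂ) ≃ₗ[ℂ] (Fin e → ℂ), ∀ g v, e (ρ g *ᵥ v) = σ g *ᵥ e v :=
    ⟨f.toLinearEquiv, fun g v => by
      rw [← matRep_apply, ← matRep_apply]; exact f.toIntertwiningMap.isIntertwining _ _ g v⟩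
  refine ⟨LinearMap.toMatrix' e.symm.toLinearMap, LinearMap.toMatrix' e.toLinearMap, ?_, ?_,
    fun g => matrix_eq_of_mulVec fun v => ?_⟩
  · rw [← LinearMap.toMatrix'_comp]; simp
  · rw [← LinearMap.toMatrix'_comp]; simp
  · rw [← Matrix.mulVec_mulVec, ← Matrix.mulVec_mulVec, LinearMap.toMatrix'_mulVec,
      LinearMap.toMatrix'_mulVec]
    simp [← he]

/-- **Schur's lemma**: a nonzero matrix that intertwines irreducible representations is an
isomorphism. -/
theorem eq_zero_or_nonempty_equiv {ρ : G →* Matrix (Fin d) (Fin d) ℂ}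
    {σ : G →* Matrix (Fin e) (Fin e) ℂ} (hρ : (matRep ρ).IsIrreducible)
    (hσ : (matRep σ).IsIrreducible) {A : Matrix (Fin d) (Fin e) ℂ}
    (hA : ∀ g, ρ g * A = A * σ g) : A = 0 ∨ Nonempty ((matRep σ).Equiv (matRep ρ)) := by
  rcases Representation.IsIrreducible.bijective_or_eq_zero (intertwiner A hA) with h | h
  · exact .inr ⟨(intertwiner A hA).ofBijective h⟩
  · left
    have : A.mulVecLin = 0 := congrArg Representation.IntertwiningMap.toLinearMap h
    apply Matrix.toLin'.injective
    rw [map_zero]; exact this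

/-- **Schur's lemma**: a matrix that commutes with an irreducible representation is scalar. -/
theorem exists_eq_smul_one_of_commute {ρ : G →* Matrix (Fin d) (Fin d) ℂ}
    (hρ : (matRep ρ).IsIrreducible) {A : Matrix (Fin d) (Fin d) ℂ}
    (hA : ∀ g, ρ g * A = A * ρ g) : ∃ c : ℂ, A = c • 1 := by
  obtain ⟨c, hc⟩ := (Representation.IsIrreducible.algebraMap_intertwiningMap_bijective_of_isAlgClosed
    (ρ := matRep ρ)).2 (intertwiner A hA)
  refine ⟨c, matrix_eq_of_mulVec fun v => ?_⟩
  have := congrFun (congrArg DFunLike.coe hc) v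
  rw [intertwiner_apply] at this
  rw [← this, Matrix.smul_mulVec, Matrix.one_mulVec]
  rfl

/-- By Maschke's theorem, a representation whose only endomorphisms are the scalars is
irreducible. -/
theorem isIrreducible_of_commute [Finite G] {ρ : G →* Matrix (Fin d) (Fin d) ℂ} (hd : 0 < d)
    (h : ∀ A : Matrix (Fin d) (Fin d) ℂ, (∀ g, ρ g * A = A * ρ g) → ∃ c : ℂ, A = c • 1) :
    (matRep ρ).IsIrreducible := by
  refine (matRep_isIrreducible_iff ρ).2 ⟨hd, fun W hW => ?_⟩
  let S : Subrepresentation (matRep ρ) :=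
    ⟨W, fun g v hv => by rw [matRep_apply]; exact hW g v hv⟩
  obtain ⟨S', hS'⟩ := exists_isCompl S
  have hc : IsCompl W S'.toSubmodule := by
    constructor
    · rw [disjoint_iff]
      exact congrArg Subrepresentation.toSubmodule hS'.inf_eq_bot
    · rw [codisjoint_iff]
      exact congrArg Subrepresentation.toSubmodule hS'.sup_eq_top
  obtain ⟨π, h1, h2, h3⟩ : ∃ π : (Fin d → ℂ) →ₗ[ℂ] (Fin d → ℂ), (∀ v, π v ∈ W) ∧
      (∀ v ∈ W, π v = v) ∧ ∀ v ∈ S'.toSubmodule, π v = 0 :=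
    ⟨W.projection _ hc, W.projection_apply_mem hc,
      fun v hv => Submodule.projection_apply_of_mem_left hc hv,
      fun v hv => (Submodule.projection_apply_eq_zero_iff hc).2 hv⟩
  obtain ⟨c, hcA⟩ := h (LinearMap.toMatrix' π) fun g => matrix_eq_of_mulVec fun v => by
    obtain ⟨a, ha, b, hb, rfl⟩ := Submodule.mem_sup.1 (hc.sup_eq_top ▸ Submodule.mem_top : v ∈ _)
    have hb' : ρ g *ᵥ b ∈ S'.toSubmodule := by
      rw [← matRep_apply]; exact S'.apply_mem_toSubmodule g hb
    simp only [← Matrix.mulVec_mulVec, LinearMap.toMatrix'_mulVec, Matrix.mulVec_add,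
      h2 a ha, h3 b hb, h2 _ (hW g a ha), h3 _ hb', Matrix.mulVec_zero]
  have hπ : ∀ v, π v = c • v := fun v => by
    rw [← LinearMap.toMatrix'_mulVec, hcA, Matrix.smul_mulVec, Matrix.one_mulVec]
  by_cases hbot : W = ⊥
  · exact .inl hbot
  · right
    obtain ⟨w, hw, hw0⟩ := Submodule.exists_mem_ne_zero_of_ne_bot hbot
    have hc1 : c = 1 := by
      have := h2 w hw
      rw [hπ] at this
      by_contra hne
      have h4 : (c - 1) • w = 0 := by rw [sub_smul, this, one_smul, sub_self]
      exact (smul_ne_zero (sub_ne_zero.2 hne) hw0) h4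
    refine eq_top_iff.2 fun v _ => ?_
    have := h1 v
    rwa [hπ, hc1, one_smul] at this

end MatrixRepresentations

/-! ### Schur orthogonality and the existence of complete sets of irreducible representations -/

section Orthogonality

open Matrix

variable {G : Type*} [Group G] [Fintype G]

theorem average_intertwines {d e : ℕ} (ρ : G →* Matrix (Fin d) (Fin d) ℂ)
    (σ : G →* Matrix (Fin e) (Fin e) ℂ) (A : Matrix (Fin d) (Fin e) ℂ) (h : G) :
    ρ h * (∑ g, ρ g * A * σ g⁻¹) = (∑ g, ρ g * A * σ g⁻¹) * σ h := by
  rw [Matrix.mul_sum, Matrix.sum_mul,     ← Equiv.sum_comp (Equiv.mulLeft h) fun g => ρ g * A * σ g⁻¹ * σ h]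
  refine Finset.sum_congr rfl fun g _ => ?_
  rw [Equiv.coe_mulLeft, map_mul, Matrix.mul_assoc _ _ (σ h), ← map_mul σ]
  simp [Matrix.mul_assoc]

theorem sum_entry_mul_entry {d e : ℕ} (ρ : G →* Matrix (Fin d) (Fin d) ℂ)
    (σ : G →* Matrix (Fin e) (Fin e) ℂ) (k l : Fin d) (u v : Fin e) :
    ∑ g, ρ g k l * σ g⁻¹ u v = (∑ g, ρ g * Matrix.single l u (1 : ℂ) * σ g⁻¹) k v := by
  rw [Matrix.sum_apply]
  refine Finset.sum_congr rfl fun g _ => ?_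
  rw [Matrix.mul_assoc, Matrix.mul_apply]
  rw [Finset.sum_eq_single l]
  · simp
  · intro b _ hb
    simp [Matrix.single_mul_apply_of_ne _ _ _ _ _ hb]
  · simp

theorem sum_entry_mul_entry_of_isEmpty {d e : ℕ} {ρ : G →* Matrix (Fin d) (Fin d) ℂ}
    {σ : G →* Matrix (Fin e) (Fin e) ℂ} (hρ : (matRep ρ).IsIrreducible)
    (hσ : (matRep σ).IsIrreducible) (h : IsEmpty ((matRep σ).Equiv (matRep ρ)))
    (k l : Fin d) (u v : Fin e) : ∑ g, ρ g k l * σ g⁻¹ u v = 0 := by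
  rw [sum_entry_mul_entry]
  rcases eq_zero_or_nonempty_equiv hρ hσ (average_intertwines ρ σ (Matrix.single l u 1)) with h1 | h1
  · rw [h1]; rfl
  · exact absurd h1 (not_nonempty_iff.2 h)

theorem sum_entry_mul_entry_self {d : ℕ} {ρ : G →* Matrix (Fin d) (Fin d) ℂ}
    (hρ : (matRep ρ).IsIrreducible) (k l u v : Fin d) :
    ∑ g, ρ g k l * ρ g⁻¹ u v = if k = v ∧ l = u then (Fintype.card G : ℂ) / d else 0 := by
  rw [sum_entry_mul_entry]
  obtain ⟨c, hc⟩ := exists_eq_smul_one_of_commute hρ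
    (average_intertwines ρ ρ (Matrix.single l u 1))
  have htr := congrArg Matrix.trace hc
  have hd : (d : ℂ) ≠ 0 := by exact_mod_cast k.pos.ne'
  have h1 : ∀ g, (ρ g * Matrix.single l u 1 * ρ g⁻¹).trace = if l = u then 1 else 0 := by
    intro g
    rw [Matrix.trace_mul_comm, ← Matrix.mul_assoc, ← map_mul, inv_mul_cancel, map_one,
      Matrix.one_mul]
    split_ifs with h
    · subst h; simp
    · simp [Matrix.trace_single_eq_of_ne _ _ _ h]
  rw [Matrix.trace_sum, Finset.sum_congr rfl fun g _ => h1 g, Matrix.trace_smul, Matrix.trace_one]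
    at htr
  rw [hc]
  simp only [Finset.sum_const, Finset.card_univ, Fintype.card_fin, smul_eq_mul] at htr
  have hc' : c = if l = u then (Fintype.card G : ℂ) / d else 0 := by
    split_ifs at htr ⊢ with h
    · rw [eq_div_iff hd, ← htr]; simp
    · simpa [hd] using htr.symm
  rw [hc', Matrix.smul_apply, Matrix.one_apply]
  by_cases h1 : k = v <;> by_cases h2 : l = u <;> simp [h1, h2]

/-- The matrix entries of pairwise inequivalent irreducible representations are linearly
independent functions on the group. -/
theorem sum_sq_dim_le {n : ℕ} {dim : Fin n → ℕ}
    {rep : ∀ i, G →* Matrix (Fin (dim i)) (Fin (dim i)) ℂ}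
    (irr : ∀ i, (matRep (rep i)).IsIrreducible)
    (ineq : ∀ i j, i ≠ j → IsEmpty ((matRep (rep i)).Equiv (matRep (rep j)))) :
    ∑ i, dim i ^ 2 ≤ Fintype.card G := by
  have hli : LinearIndependent ℂ
      (fun (q : Σ i, Fin (dim i) × Fin (dim i)) (g : G) => rep q.1 g q.2.1 q.2.2) := by
    refine Fintype.linearIndependent_iff.2 fun c hc => ?_
    rintro ⟨j, a, b⟩
    have hd : (dim j : ℂ) ≠ 0 := by exact_mod_cast a.pos.ne'
    have hG : (Fintype.card G : ℂ) ≠ 0 := by exact_mod_cast Fintype.card_ne_zero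
    have h0 : ∑ g, (∑ q : Σ i, Fin (dim i) × Fin (dim i),
        c q * rep q.1 g q.2.1 q.2.2) * rep j g⁻¹ b a = 0 := by
      refine Finset.sum_eq_zero fun g _ => ?_
      have := congrFun hc g
      simp only [Finset.sum_apply, Pi.smul_apply, smul_eq_mul, Pi.zero_apply] at this
      rw [this, zero_mul]
    simp only [Finset.sum_mul] at h0
    rw [Finset.sum_comm] at h0
    simp only [mul_assoc, ← Finset.mul_sum] at h0
    rw [Finset.sum_eq_single (⟨j, a, b⟩ : Σ i, Fin (dim i) × Fin (dim i))] at h0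
    · rw [sum_entry_mul_entry_self (irr j), if_pos ⟨rfl, rfl⟩] at h0
      exact (mul_eq_zero.1 h0).resolve_right (div_ne_zero hG hd)
    · rintro ⟨i, k, l⟩ - hne
      by_cases hij : i = j
      · subst hij
        rw [sum_entry_mul_entry_self (irr i), if_neg, mul_zero]
        rintro ⟨rfl, rfl⟩
        exact hne rfl
      · rw [sum_entry_mul_entry_of_isEmpty (irr i) (irr j) (ineq j i (Ne.symm hij)), mul_zero]
    · simp
  have := hli.fintype_card_le_finrank
  simpa [Fintype.card_sigma, sq] using this

theorem CompleteIrreps.sum_sq_dim_le (I : CompleteIrreps G) :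
    ∑ i, I.dim i ^ 2 ≤ Fintype.card G :=
  _root_.sum_sq_dim_le I.irreducible I.inequivalent

theorem CompleteIrreps.dim_pos {G : Type*} [Group G] (I : CompleteIrreps G) (i : Fin I.num) :
    0 < I.dim i :=
  ((matRep_isIrreducible_iff _).1 (I.irreducible i)).1

/-- A largest family of pairwise inequivalent irreducible representations is complete. -/
theorem nonempty_completeIrreps (G : Type*) [Group G] [Finite G] :
    Nonempty (CompleteIrreps G) := by
  have := Fintype.ofFinite G
  let P : ℕ → Prop := fun n => ∃ r : Fin n → Σ d, (G →* Matrix (Fin d) (Fin d) ℂ),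
    (∀ i, (matRep (r i).2).IsIrreducible) ∧
      ∀ i j, i ≠ j → IsEmpty ((matRep (r i).2).Equiv (matRep (r j).2))
  have hbdd : ∀ n, P n → n ≤ Fintype.card G := by
    rintro n ⟨r, h1, h2⟩
    refine le_trans ?_ (sum_sq_dim_le h1 h2)
    calc n = ∑ _i : Fin n, 1 := by simp
      _ ≤ _ := Finset.sum_le_sum fun i _ =>
        Nat.one_le_pow _ _ ((matRep_isIrreducible_iff _).1 (h1 i)).1
  obtain ⟨r, h1, h2⟩ : P (sSup {n | P n}) :=
    Nat.sSup_mem (s := {n | P n}) ⟨0, Fin.elim0, fun i => i.elim0, fun i => i.elim0⟩ ⟨_, hbdd⟩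
  refine ⟨⟨_, fun i => (r i).1, fun i => (r i).2, h1, h2, fun d σ hσ => ?_⟩⟩
  by_contra hne
  push Not at hne
  have hP : P (sSup {n | P n} + 1) := by
    refine ⟨Fin.cons ⟨d, σ⟩ r, fun i => ?_, fun i j => ?_⟩
    · refine Fin.cases ?_ (fun i => ?_) i
      · exact hσ
      · exact h1 i
    · refine Fin.cases ?_ (fun i => ?_) i <;> refine Fin.cases ?_ (fun j => ?_) j
      · simp
      · intro _
        exact hne j
      · intro _
        exact ⟨fun f => (hne i).false f.symm⟩
      · intro hij
        exact h2 i j fun h => hij (h ▸ rfl)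
  exact absurd (le_csSup (s := {n | P n}) ⟨_, hbdd⟩ hP) (by omega)

end Orthogonality

/-! ### Restriction to a normal subgroup of prime index -/

section Clifford

open Matrix

variable {G : Type*} [Group G] {p : ℕ} {χ : G →* ℂˣ} {t : G}

theorem pow_mem_ker (hχ : ∀ g, χ g ^ p = 1) (g : G) : g ^ p ∈ χ.ker := by
  rw [MonoidHom.mem_ker, map_pow, hχ]

/-- The elements of the group are the products `h * t ^ j` with `h` in the kernel of the character
and `j < p`. -/
theorem exists_mul_pow (hχ : ∀ g, χ g ^ p = 1) (ht : IsPrimitiveRoot (χ t) p) [NeZero p] (g : G) :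
    ∃ h ∈ χ.ker, ∃ j < p, g = h * t ^ j := by
  obtain ⟨j, hj, hg'⟩ := (IsPrimitiveRoot.coe_units_iff.2 ht).eq_pow_of_pow_eq_one
    (ξ := (χ g : ℂ)) (by rw [← Units.val_pow_eq_pow_val, hχ, Units.val_one])
  have hg : χ t ^ j = χ g := Units.ext (by simpa using hg')
  refine ⟨g * (t ^ j)⁻¹, ?_, j, hj, by group⟩
  rw [MonoidHom.mem_ker, map_mul, map_inv, map_pow, hg, mul_inv_cancel]

theorem bijective_mul_pow (hχ : ∀ g, χ g ^ p = 1) (ht : IsPrimitiveRoot (χ t) p) [NeZero p] :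
    Function.Bijective fun q : χ.ker × Fin p => (q.1 : G) * t ^ (q.2 : ℕ) := by
  constructor
  · rintro ⟨h, j⟩ ⟨h', j'⟩ heq
    simp only at heq
    have h1 := congrArg χ heq
    rw [map_mul, map_mul, h.2, h'.2, one_mul, one_mul, map_pow, map_pow] at h1
    have h2 : j = j' := Fin.ext (ht.pow_inj j.isLt j'.isLt h1)
    subst h2
    rw [mul_left_inj] at heq
    exact Prod.ext (Subtype.ext heq) rfl
  · intro g
    obtain ⟨h, hh, j, hj, rfl⟩ := exists_mul_pow hχ ht g
    exact ⟨(⟨h, hh⟩, ⟨j, hj⟩), rfl⟩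

variable {D : ℕ} {ρ : G →* Matrix (Fin D) (Fin D) ℂ}

/-- Invariance under a group generated by a normal subgroup and one more element. -/
theorem mulVec_mem_of_ker (hχ : ∀ g, χ g ^ p = 1) (ht : IsPrimitiveRoot (χ t) p) [NeZero p]
    {W : Submodule ℂ (Fin D → ℂ)} (h1 : ∀ h ∈ χ.ker, ∀ v ∈ W, ρ h *ᵥ v ∈ W)
    (h2 : ∀ v ∈ W, ρ t *ᵥ v ∈ W) (g : G) (v : Fin D → ℂ) (hv : v ∈ W) : ρ g *ᵥ v ∈ W := by
  obtain ⟨h, hh, j, -, rfl⟩ := exists_mul_pow hχ ht g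
  have h3 : ∀ j : ℕ, ρ (t ^ j) *ᵥ v ∈ W := by
    intro j
    induction j with
    | zero => simpa using hv
    | succ j ih =>
      rw [pow_succ', map_mul, ← Matrix.mulVec_mulVec]
      exact h2 _ ih
  rw [map_mul, ← Matrix.mulVec_mulVec]
  exact h1 h hh _ (h3 j)

theorem commute_of_ker (hχ : ∀ g, χ g ^ p = 1) (ht : IsPrimitiveRoot (χ t) p) [NeZero p]
    {A : Matrix (Fin D) (Fin D) ℂ} (h1 : ∀ h ∈ χ.ker, ρ h * A = A * ρ h)
    (h2 : ρ t * A = A * ρ t) (g : G) : ρ g * A = A * ρ g := by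
  obtain ⟨h, hh, j, -, rfl⟩ := exists_mul_pow hχ ht g
  have h3 : Commute (ρ (t ^ j)) A := by
    rw [map_pow]; exact Commute.pow_left h2 j
  rw [map_mul]
  exact Commute.mul_left (h1 h hh) h3

theorem map_mul_map_inv (ρ : G →* Matrix (Fin D) (Fin D) ℂ) (g : G) : ρ g * ρ g⁻¹ = 1 := by
  rw [← map_mul, mul_inv_cancel, map_one]

theorem map_inv_mul_map (ρ : G →* Matrix (Fin D) (Fin D) ℂ) (g : G) : ρ g⁻¹ * ρ g = 1 := by
  rw [← map_mul, inv_mul_cancel, map_one]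

/-- Two extensions of an irreducible representation of the kernel of `χ` differ by a power
of `χ`. -/
theorem exists_eq_smul_of_extension (hχ : ∀ g, χ g ^ p = 1)
    (ht : IsPrimitiveRoot (χ t) p) [NeZero p]
    {σ : χ.ker →* Matrix (Fin D) (Fin D) ℂ} (hσ : (matRep σ).IsIrreducible)
    {S : G →* Matrix (Fin D) (Fin D) ℂ} (hρσ : ∀ h : χ.ker, ρ h = σ h)
    (hSσ : ∀ h : χ.ker, S h = σ h) : ∃ k < p, ρ t = (χ t : ℂ) ^ k • S t := by
  have hD : 0 < D := ((matRep_isIrreducible_iff σ).1 hσ).1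
  have : Nonempty (Fin D) := ⟨⟨0, hD⟩⟩
  obtain ⟨c, hc⟩ := exists_eq_smul_one_of_commute hσ (A := ρ t * S t⁻¹) fun h => by
    have hmem : t⁻¹ * h * t ∈ χ.ker := by
      simpa using χ.normal_ker.conj_mem h h.2 t⁻¹
    have h1 : S t⁻¹ * σ h = σ ⟨_, hmem⟩ * S t⁻¹ := by
      rw [← hSσ, ← hSσ, ← map_mul, ← map_mul]; congr 1; simp
    rw [Matrix.mul_assoc, h1, ← hρσ, ← hρσ, ← Matrix.mul_assoc, ← Matrix.mul_assoc, ← map_mul,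
      ← map_mul]
    congr 2; simp [mul_assoc]
  have h1 : ρ t = c • S t := by
    have := congrArg (· * S t) hc
    simpa [Matrix.mul_assoc, map_inv_mul_map] using this
  have h2 : c ^ p = 1 := by
    have h3 : ρ (t ^ p) = c ^ p • S (t ^ p) := by
      rw [map_pow, map_pow, h1, smul_pow]
    rw [show ρ (t ^ p) = S (t ^ p) from
      (hρσ ⟨_, pow_mem_ker hχ t⟩).trans (hSσ ⟨_, pow_mem_ker hχ t⟩).symm] at h3
    have h4 := congrArg (· * S (t ^ p)⁻¹) h3
    simp only [Matrix.smul_mul, map_mul_map_inv] at h4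
    have h5 := congrFun (congrFun h4 ⟨0, hD⟩) ⟨0, hD⟩
    simpa using h5.symm
  have ht' : IsPrimitiveRoot (χ t : ℂ) p := IsPrimitiveRoot.coe_units_iff.2 ht
  obtain ⟨k, hk, rfl⟩ := ht'.eq_pow_of_pow_eq_one h2
  exact ⟨k, hk, h1⟩

/-- If an irreducible representation `ρ` becomes reducible on the kernel of `χ`, some nonzero matrix
commutes with `ρ` up to a nontrivial power of `χ`: for `A` commuting with the restriction, the sums
`∑ j, ζ ^ (k * j) • ρ (t ^ j) * A * ρ (t ^ j)⁻¹` are such matrices for `0 < k < p`, and if they all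
vanish, then `A` is a multiple of the sum for `k = 0`, which commutes with `ρ`. -/
theorem exists_twisted_commute [Finite G] (hp : p.Prime) (hχ : ∀ g, χ g ^ p = 1)
    (ht : IsPrimitiveRoot (χ t) p) (hρ : (matRep ρ).IsIrreducible)
    (hres : ¬ (matRep (ρ.comp χ.ker.subtype)).IsIrreducible) :
    ∃ (X : Matrix (Fin D) (Fin D) ℂ) (η : ℂ), X ≠ 0 ∧ IsPrimitiveRoot η p ∧
      (∀ h ∈ χ.ker, ρ h * X = X * ρ h) ∧ X * ρ t = η • (ρ t * X) := by
  have : NeZero p := ⟨hp.ne_zero⟩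
  have hζ : IsPrimitiveRoot (χ t : ℂ) p := IsPrimitiveRoot.coe_units_iff.2 ht
  have hD : 0 < D := ((matRep_isIrreducible_iff ρ).1 hρ).1
  obtain ⟨A, hA, hAs⟩ : ∃ A : Matrix (Fin D) (Fin D) ℂ,
      (∀ h ∈ χ.ker, ρ h * A = A * ρ h) ∧ ¬ ∃ c : ℂ, A = c • 1 := by
    by_contra! hcon
    exact hres (isIrreducible_of_commute hD fun A hA =>
      by simpa using hcon A fun h hh => hA ⟨h, hh⟩)
  set ζ : ℂ := ((χ t : ℂˣ) : ℂ)
  obtain ⟨f, hf⟩ : ∃ f : ℕ → Matrix (Fin D) (Fin D) ℂ,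
      ∀ j, f j = ρ (t ^ j) * A * ρ (t ^ j)⁻¹ := ⟨_, fun _ => rfl⟩
  have hf0 : f 0 = A := by simp [hf]
  have hfp : f p = A := by
    rw [hf, hA _ (pow_mem_ker hχ t), Matrix.mul_assoc, map_mul_map_inv, Matrix.mul_one]
  have hfT : ∀ j, f (j + 1) * ρ t = ρ t * f j := by
    intro j
    rw [hf, hf, pow_succ' t j, _root_.mul_inv_rev, map_mul, map_mul]
    simp only [Matrix.mul_assoc, map_inv_mul_map, Matrix.mul_one]
  have hfH : ∀ j, ∀ h ∈ χ.ker, ρ h * f j = f j * ρ h := by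
    intro j h hh
    have hmem : (t ^ j)⁻¹ * h * t ^ j ∈ χ.ker := by
      simpa using χ.normal_ker.conj_mem h hh (t ^ j)⁻¹
    have h1 : ρ h * ρ (t ^ j) = ρ (t ^ j) * ρ ((t ^ j)⁻¹ * h * t ^ j) := by
      rw [← map_mul, ← map_mul]; congr 1; group
    have h2 : ρ (t ^ j)⁻¹ * ρ h = ρ ((t ^ j)⁻¹ * h * t ^ j) * ρ (t ^ j)⁻¹ := by
      rw [← map_mul, ← map_mul]; congr 1; group
    rw [hf, ← Matrix.mul_assoc, ← Matrix.mul_assoc, h1, Matrix.mul_assoc (ρ (t ^ j)), hA _ hmem,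
      Matrix.mul_assoc _ _ (ρ h), h2]
    simp only [Matrix.mul_assoc]
  obtain ⟨B, hB⟩ : ∃ B : ℕ → Matrix (Fin D) (Fin D) ℂ,
      ∀ k, B k = ∑ j ∈ Finset.range p, (ζ ^ k) ^ j • f j := ⟨_, fun _ => rfl⟩
  have hBT : ∀ k, B k * ρ t = ζ ^ k • (ρ t * B k) := by
    intro k
    have h1 : B k = ∑ j ∈ Finset.range p, (ζ ^ k) ^ (j + 1) • f (j + 1) := by
      have := Finset.sum_range_succ' (fun j => (ζ ^ k) ^ j • f j) p
      rw [Finset.sum_range_succ, ← hB, hfp, ← pow_mul, mul_comm, pow_mul, hζ.pow_eq_one] at this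
      simpa [hf0] using this
    conv_lhs => rw [h1]
    rw [hB, Matrix.sum_mul, Matrix.mul_sum, Finset.smul_sum]
    refine Finset.sum_congr rfl fun j _ => ?_
    rw [Matrix.smul_mul, hfT, Matrix.mul_smul, smul_smul, pow_succ']
  have hBH : ∀ k, ∀ h ∈ χ.ker, ρ h * B k = B k * ρ h := by
    intro k h hh
    rw [hB, Matrix.sum_mul, Matrix.mul_sum]
    refine Finset.sum_congr rfl fun j _ => ?_
    rw [Matrix.smul_mul, Matrix.mul_smul, hfH j h hh]
  have hsum : ∑ k ∈ Finset.range p, B k = (p : ℂ) • A := by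
    simp only [hB]
    rw [Finset.sum_comm, Finset.sum_eq_single 0]
    · simp [hf0, Nat.cast_smul_eq_nsmul]
    · intro j hj hj0
      rw [← Finset.sum_smul]
      have h1 : ∑ k ∈ Finset.range p, (ζ ^ k) ^ j = 0 := by
        have h2 := geom_sum_mul (ζ ^ j) p
        rw [← pow_mul, mul_comm j, pow_mul, hζ.pow_eq_one, one_pow, sub_self] at h2
        have h3 : ζ ^ j - 1 ≠ 0 :=
          sub_ne_zero.2 (hζ.pow_ne_one_of_pos_of_lt hj0 (Finset.mem_range.1 hj))
        rw [← (mul_eq_zero.1 h2).resolve_right h3]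
        exact Finset.sum_congr rfl fun k _ => by rw [← pow_mul, ← pow_mul, mul_comm]
      rw [h1, zero_smul]
    · intro h; exact absurd (Finset.mem_range.2 hp.pos) h
  obtain ⟨k, hk0, hkp, hBk⟩ : ∃ k, 0 < k ∧ k < p ∧ B k ≠ 0 := by
    by_contra! hcon
    have h1 : B 0 = (p : ℂ) • A := by
      rw [← hsum, Finset.sum_eq_single 0]
      · intro k hk hk0
        exact hcon k (Nat.pos_of_ne_zero hk0) (Finset.mem_range.1 hk)
      · intro h; exact absurd (Finset.mem_range.2 hp.pos) h
    obtain ⟨c, hc⟩ := exists_eq_smul_one_of_commute hρ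
      (commute_of_ker hχ ht (hBH 0) (by simpa using (hBT 0).symm))
    refine hAs ⟨(p : ℂ)⁻¹ * c, ?_⟩
    rw [mul_smul, ← hc, h1, smul_smul, inv_mul_cancel₀ (by exact_mod_cast hp.ne_zero), one_smul]
  exact ⟨B k, ζ ^ k, hBk, hζ.pow_of_coprime k
    (Nat.Coprime.symm ((Nat.Prime.coprime_iff_not_dvd hp).2 (Nat.not_dvd_of_pos_of_lt hk0 hkp))), hBH k, hBT k⟩

end Clifford

/-! ### Block decomposition of a representation that becomes reducible -/

section CliffordDecomposition

open Matrix

/-- A subspace of `ℂ ^ D` as the column space of a matrix with a left inverse. -/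
theorem exists_matrix_of_submodule {D : ℕ} (W : Submodule ℂ (Fin D → ℂ)) :
    ∃ (d : ℕ) (E : Matrix (Fin D) (Fin d) ℂ) (L : Matrix (Fin d) (Fin D) ℂ), L * E = 1 ∧
      (∀ v, E *ᵥ v ∈ W) ∧ ∀ w ∈ W, E *ᵥ (L *ᵥ w) = w := by
  let b := Module.finBasis ℂ W
  let f : (Fin (Module.finrank ℂ W) → ℂ) →ₗ[ℂ] (Fin D → ℂ) :=
    W.subtype ∘ₗ b.equivFun.symm.toLinearMap
  have hf : LinearMap.ker f = ⊥ := by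
    rw [LinearMap.ker_eq_bot]
    exact W.subtype_injective.comp b.equivFun.symm.injective
  obtain ⟨g, hg⟩ := LinearMap.exists_leftInverse_of_injective f hf
  have hg' : ∀ v, g (f v) = v := fun v => LinearMap.congr_fun hg v
  refine ⟨_, LinearMap.toMatrix' f, LinearMap.toMatrix' g, ?_, fun v => ?_, fun w hw => ?_⟩
  · rw [← LinearMap.toMatrix'_comp, hg, LinearMap.toMatrix'_id]
  · rw [LinearMap.toMatrix'_mulVec]
    exact (b.equivFun.symm v).2
  · rw [LinearMap.toMatrix'_mulVec, LinearMap.toMatrix'_mulVec]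
    have : w = f (b.equivFun ⟨w, hw⟩) := by simp [f]
    rw [this, hg']

variable {G : Type*} [Group G] {p : ℕ} {χ : G →* ℂˣ} {t : G}

/-- The shape of an irreducible representation `ρ` of dimension `D` that becomes reducible on the
kernel of `χ`: in the basis formed by the columns of `E 0, …, E (p - 1)`, with dual basis the rows of
`F 0, …, F (p - 1)`, the kernel acts by diagonal blocks, each of them an irreducible representation
`σ a`, and `t` permutes the blocks cyclically.

A matrix `X` that commutes with `ρ` up to a nontrivial power of `χ` has an eigenspace, which is
invariant under the kernel. If `W` is a minimal invariant subspace of it, the translates of `W` by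
powers of `t` lie in different eigenspaces, so their sum is direct, and this sum is invariant under
the whole group. -/
theorem exists_block_decomposition [Finite G] (hp : p.Prime) (hχ : ∀ g, χ g ^ p = 1)
    (ht : IsPrimitiveRoot (χ t) p) {D : ℕ} {ρ : G →* Matrix (Fin D) (Fin D) ℂ}
    (hρ : (matRep ρ).IsIrreducible)
    (hres : ¬ (matRep (ρ.comp χ.ker.subtype)).IsIrreducible) :
    ∃ (d : ℕ) (σ : Fin p → (χ.ker →* Matrix (Fin d) (Fin d) ℂ))
      (E : Fin p → Matrix (Fin D) (Fin d) ℂ) (F : Fin p → Matrix (Fin d) (Fin D) ℂ),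
      p * d = D ∧ (∀ a, (matRep (σ a)).IsIrreducible) ∧ ∑ a, E a * F a = 1 ∧
      (∀ a (h : χ.ker), F a * ρ h = σ a h * F a) ∧
      ∀ (a b : Fin p) (j : ℕ), ¬ a ≡ b + j [MOD p] → F a * ρ (t ^ j) * E b = 0 := by
  have : NeZero p := ⟨hp.ne_zero⟩
  obtain ⟨hD, hirr⟩ := (matRep_isIrreducible_iff ρ).1 hρ
  have : Nonempty (Fin D) := ⟨⟨0, hD⟩⟩
  obtain ⟨X, η, hX0, hη, hXH, hXT⟩ := exists_twisted_commute hp hχ ht hρ hres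
  have hXj : ∀ j, X * ρ (t ^ j) = η ^ j • (ρ (t ^ j) * X) := by
    intro j
    induction j with
    | zero => simp
    | succ j ih =>
      rw [pow_succ t, map_mul, ← Matrix.mul_assoc, ih, Matrix.smul_mul, Matrix.mul_assoc, hXT,
        Matrix.mul_smul, smul_smul, Matrix.mul_assoc, pow_succ]
  -- `X` is injective: its kernel is invariant under the whole group.
  have hker : ∀ v, X *ᵥ v = 0 → v = 0 := by
    have h1 := hirr (LinearMap.ker X.mulVecLin) (mulVec_mem_of_ker hχ ht
      (fun h hh v hv => by
        simp only [LinearMap.mem_ker, Matrix.mulVecLin_apply] at hv ⊢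
        rw [Matrix.mulVec_mulVec, ← hXH h hh, ← Matrix.mulVec_mulVec, hv, Matrix.mulVec_zero])
      (fun v hv => by
        simp only [LinearMap.mem_ker, Matrix.mulVecLin_apply] at hv ⊢
        rw [Matrix.mulVec_mulVec, hXT, Matrix.smul_mulVec, ← Matrix.mulVec_mulVec, hv,
          Matrix.mulVec_zero, smul_zero]))
    rcases h1 with h1 | h1
    · intro v hv
      exact LinearMap.ker_eq_bot'.1 h1 v (by simpa using hv)
    · refine absurd (matrix_eq_of_mulVec fun v => ?_) hX0
      have : v ∈ LinearMap.ker X.mulVecLin := h1 ▸ Submodule.mem_top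
      simpa using this
  obtain ⟨lam, hlam⟩ := Module.End.exists_eigenvalue (K := ℂ) X.mulVecLin
  have hlam0 : lam ≠ 0 := by
    rintro rfl
    obtain ⟨v, hv⟩ := hlam.exists_hasEigenvector
    exact hv.2 (hker v (by simpa using hv.apply_eq_smul))
  -- A minimal invariant subspace of the eigenspace.
  obtain ⟨W, ⟨hW0, hWeig, hWinv⟩, hWmin⟩ := WellFounded.has_min
    (wellFounded_lt (α := Submodule ℂ (Fin D → ℂ)))
    {W | W ≠ ⊥ ∧ (∀ v ∈ W, X *ᵥ v = lam • v) ∧ ∀ h ∈ χ.ker, ∀ v ∈ W, ρ h *ᵥ v ∈ W}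
    ⟨Module.End.eigenspace X.mulVecLin lam, hlam, fun v hv => by
      simpa using Module.End.mem_eigenspace_iff.1 hv, fun h hh v hv => by
        rw [Module.End.mem_eigenspace_iff] at hv ⊢
        simp only [Matrix.mulVecLin_apply] at hv ⊢
        rw [Matrix.mulVec_mulVec, ← hXH h hh, ← Matrix.mulVec_mulVec, hv, Matrix.mulVec_smul]⟩
  obtain ⟨d, E, L, hLE, hEW, hEL⟩ := exists_matrix_of_submodule W
  have hLE' : ∀ v, L *ᵥ (E *ᵥ v) = v := fun v => by
    rw [Matrix.mulVec_mulVec, hLE, Matrix.one_mulVec]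
  have hd : 0 < d := by
    obtain ⟨w, hw, hw0⟩ := Submodule.exists_mem_ne_zero_of_ne_bot hW0
    rcases Nat.eq_zero_or_pos d with rfl | hd
    · refine absurd ?_ hw0
      rw [← hEL w hw, Subsingleton.elim (L *ᵥ w) 0, Matrix.mulVec_zero]
    · exact hd
  have hELρ : ∀ h ∈ χ.ker, E * (L * (ρ h * E)) = ρ h * E := fun h hh =>
    matrix_eq_of_mulVec fun v => by
      simp only [← Matrix.mulVec_mulVec]
      exact hEL _ (hWinv h hh _ (hEW v))
  -- The action of the kernel on `W`, and its conjugates by powers of `t`.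
  obtain ⟨τ, hτ⟩ : ∃ τ : χ.ker →* Matrix (Fin d) (Fin d) ℂ, ∀ h : χ.ker, ρ h * E = E * τ h := by
    refine ⟨⟨⟨fun h => L * (ρ h * E), by simpa using hLE⟩, fun h h' => ?_⟩, fun h => ?_⟩
    · have := hELρ h' h'.2
      simp only [Subgroup.coe_mul, map_mul, Matrix.mul_assoc]
      rw [this]
    · exact (hELρ h h.2).symm
  obtain ⟨σ, hσ⟩ : ∃ σ : Fin p → (χ.ker →* Matrix (Fin d) (Fin d) ℂ), ∀ a h,
      σ a h = τ (MulAut.conjNormal (t ^ (a : ℕ))⁻¹ h) :=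
    ⟨fun a => τ.comp (MulAut.conjNormal (t ^ (a : ℕ))⁻¹).toMonoidHom, fun a h => rfl⟩
  have hσE : ∀ (a : Fin p) (h : χ.ker), ρ h * (ρ (t ^ (a : ℕ)) * E) = ρ (t ^ (a : ℕ)) * E * σ a h := by
    intro a h
    rw [hσ, Matrix.mul_assoc, ← hτ, ← Matrix.mul_assoc, ← Matrix.mul_assoc, ← map_mul, ← map_mul]
    congr 2
    rw [MulAut.conjNormal_apply]
    group
  have hσirr : ∀ a, (matRep (σ a)).IsIrreducible := by
    intro a
    refine (matRep_isIrreducible_iff _).2 ⟨hd, fun U hU => ?_⟩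
    have hUτ : ∀ (h : χ.ker), ∀ v ∈ U, τ h *ᵥ v ∈ U := by
      intro h v hv
      have := hU (MulAut.conjNormal (t ^ (a : ℕ)) h) v hv
      rw [hσ] at this
      simpa using this
    by_cases hmap : U.map E.mulVecLin = ⊥
    · left
      refine (Submodule.eq_bot_iff _).2 fun u hu => ?_
      have h1 : E *ᵥ u = 0 := by
        have : E.mulVecLin u ∈ U.map E.mulVecLin := Submodule.mem_map_of_mem hu
        rw [hmap] at this
        simpa using this
      rw [← hLE' u, h1, Matrix.mulVec_zero]
    · right
      have hle : U.map E.mulVecLin ≤ W := by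
        rintro _ ⟨u, -, rfl⟩
        exact hEW u
      have h1 := hWmin (U.map E.mulVecLin) ⟨hmap, fun v hv => hWeig v (hle hv), by
        rintro h hh _ ⟨u, hu, rfl⟩
        refine ⟨τ ⟨h, hh⟩ *ᵥ u, hUτ _ _ hu, ?_⟩
        simp only [Matrix.mulVecLin_apply, Matrix.mulVec_mulVec]
        rw [← hτ]⟩
      have h2 : U.map E.mulVecLin = W := by
        by_contra hne
        exact h1 (lt_of_le_of_ne hle hne)
      refine eq_top_iff.2 fun v _ => ?_
      have h3 : E *ᵥ v ∈ U.map E.mulVecLin := h2 ▸ hEW v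
      obtain ⟨u, hu, huv⟩ := h3
      rw [← hLE' v, ← huv, Matrix.mulVecLin_apply, hLE']
      exact hu
  have hXE : ∀ j : ℕ, X * (ρ (t ^ j) * E) = (η ^ j * lam) • (ρ (t ^ j) * E) := by
    intro j
    have h1 : X * E = lam • E := matrix_eq_of_mulVec fun v => by
      rw [← Matrix.mulVec_mulVec, hWeig _ (hEW v), Matrix.smul_mulVec]
    rw [← Matrix.mul_assoc, hXj, Matrix.smul_mul, Matrix.mul_assoc, h1, Matrix.mul_smul, smul_smul]
  have hTE : ∀ (j : ℕ) v, (ρ (t ^ j) * E) *ᵥ v = 0 → v = 0 := by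
    intro j v hv
    have h1 := congrArg (fun w => L *ᵥ (ρ (t ^ j)⁻¹ *ᵥ w)) hv
    simp only [Matrix.mulVec_mulVec, Matrix.mulVec_zero] at h1
    rw [← Matrix.mul_assoc (ρ (t ^ j)⁻¹), map_inv_mul_map, Matrix.one_mul, hLE,
      Matrix.one_mulVec] at h1
    exact h1
  -- The sum of the translates of `W`.
  let Φ : (Fin p → Fin d → ℂ) →ₗ[ℂ] (Fin D → ℂ) :=
    ∑ a : Fin p, (ρ (t ^ (a : ℕ)) * E).mulVecLin ∘ₗ LinearMap.proj a
  have hΦ : ∀ v, Φ v = ∑ a : Fin p, (ρ (t ^ (a : ℕ)) * E) *ᵥ v a := fun v => by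
    simp [Φ, LinearMap.sum_apply]
  have hΦs : ∀ a u, Φ (Pi.single a u) = (ρ (t ^ (a : ℕ)) * E) *ᵥ u := fun a u => by
    rw [hΦ, Finset.sum_eq_single a]
    · simp
    · intro b _ hb
      rw [Pi.single_eq_of_ne hb, Matrix.mulVec_zero]
    · simp
  have hinj : LinearMap.ker Φ = ⊥ := by
    refine LinearMap.ker_eq_bot'.2 fun v hv => ?_
    have hμ : Function.Injective fun a : Fin p => η ^ (a : ℕ) * lam := fun a b hab =>
      Fin.ext (hη.pow_inj a.isLt b.isLt (mul_right_cancel₀ hlam0 hab))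
    have hind := (Module.End.eigenspaces_iSupIndep X.mulVecLin).comp hμ
    rw [iSupIndep_iff_finsetSum_eq_zero_imp_eq_zero] at hind
    ext1 a
    have := hind Finset.univ (fun a => (ρ (t ^ (a : ℕ)) * E) *ᵥ v a) (fun a _ => by
      simp only [Function.comp_apply]
      rw [Module.End.mem_eigenspace_iff, Matrix.mulVecLin_apply, Matrix.mulVec_mulVec, hXE,
        Matrix.smul_mulVec]) (by rw [← hΦ]; exact hv) a (Finset.mem_univ a)
    exact hTE _ _ this
  have hsurj : LinearMap.range Φ = ⊤ := by
    have hmem : ∀ a u, (ρ (t ^ ((a : Fin p) : ℕ)) * E) *ᵥ u ∈ LinearMap.range Φ :=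
      fun a u => ⟨_, hΦs a u⟩
    refine (hirr _ (mulVec_mem_of_ker hχ ht ?_ ?_)).resolve_left ?_
    · rintro h hh _ ⟨v, rfl⟩
      rw [hΦ, Matrix.mulVec_sum]
      refine Submodule.sum_mem _ fun a _ => ?_
      rw [Matrix.mulVec_mulVec, hσE a ⟨h, hh⟩, ← Matrix.mulVec_mulVec]
      exact hmem a _
    · rintro _ ⟨v, rfl⟩
      rw [hΦ, Matrix.mulVec_sum]
      refine Submodule.sum_mem _ fun a _ => ?_
      rw [Matrix.mulVec_mulVec, ← Matrix.mul_assoc, ← map_mul, ← pow_succ']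
      by_cases ha : (a : ℕ) + 1 < p
      · exact hmem ⟨_, ha⟩ _
      · have ha' : (a : ℕ) + 1 = p := by have := a.isLt; omega
        rw [ha', hτ ⟨_, pow_mem_ker hχ t⟩, ← Matrix.mulVec_mulVec]
        simpa using hmem 0 (τ ⟨_, pow_mem_ker hχ t⟩ *ᵥ v a)
    · intro hbot
      have h1 := hmem 0 (fun _ => 1)
      rw [hbot] at h1
      have h2 := hTE _ _ ((Submodule.mem_bot ℂ).1 h1)
      exact one_ne_zero (congrFun h2 ⟨0, hd⟩)
  let e := LinearEquiv.ofBijective Φ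
    ⟨LinearMap.ker_eq_bot.1 hinj, LinearMap.range_eq_top.1 hsurj⟩
  have he : ∀ v, e v = Φ v := fun _ => rfl
  let F : Fin p → Matrix (Fin d) (Fin D) ℂ := fun a =>
    LinearMap.toMatrix' (LinearMap.proj a ∘ₗ e.symm.toLinearMap)
  have hF : ∀ a w, F a *ᵥ w = e.symm w a := fun a w => by
    simp [F, LinearMap.toMatrix'_mulVec]
  have hEF : ∑ a : Fin p, ρ (t ^ (a : ℕ)) * E * F a = 1 := matrix_eq_of_mulVec fun w => by
    rw [Matrix.sum_mulVec, Matrix.one_mulVec]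
    simp only [← Matrix.mulVec_mulVec _ _ (F _), hF]
    conv_rhs => rw [← e.apply_symm_apply w, he, hΦ]
  have hFE : ∀ a b : Fin p, F a * (ρ (t ^ (b : ℕ)) * E) = if a = b then 1 else 0 := fun a b =>
    matrix_eq_of_mulVec fun u => by
      rw [← Matrix.mulVec_mulVec, hF, ← hΦs, ← he, e.symm_apply_apply]
      split_ifs with hab
      · subst hab; simp
      · rw [Pi.single_eq_of_ne hab, Matrix.zero_mulVec]
  -- An operator that is block diagonal in the basis `E` is so in the dual basis.
  have hdual : ∀ (M : Matrix (Fin D) (Fin D) ℂ) (N : Fin p → Matrix (Fin d) (Fin d) ℂ),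
      (∀ b : Fin p, M * (ρ (t ^ (b : ℕ)) * E) = ρ (t ^ (b : ℕ)) * E * N b) →
      ∀ a, F a * M = N a * F a := by
    intro M N hMN a
    calc F a * M = F a * M * ∑ b : Fin p, ρ (t ^ (b : ℕ)) * E * F b := by rw [hEF, Matrix.mul_one]
      _ = ∑ b : Fin p, F a * (ρ (t ^ (b : ℕ)) * E) * N b * F b := by
          rw [Matrix.mul_sum]
          refine Finset.sum_congr rfl fun b _ => ?_
          rw [Matrix.mul_assoc (F a), Matrix.mul_assoc (F a), ← hMN]
          simp only [Matrix.mul_assoc]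
      _ = N a * F a := by
          rw [Finset.sum_eq_single a]
          · rw [hFE, if_pos rfl, Matrix.one_mul]
          · intro b _ hb
            rw [hFE, if_neg (Ne.symm hb), Matrix.zero_mul, Matrix.zero_mul]
          · simp
  refine ⟨d, σ, fun a => ρ (t ^ (a : ℕ)) * E, F, ?_, hσirr, hEF,
    fun a h => hdual (ρ h) (fun b => σ b h) (fun b => hσE b h) a, fun a b j hab => ?_⟩
  · have := e.finrank_eq
    simpa [Module.finrank_pi_fintype] using this
  · have h1 := hdual X (fun b => (η ^ (b : ℕ) * lam) • 1) (fun b => by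
      rw [hXE, Matrix.mul_smul, Matrix.mul_one]) a
    have h2 : ρ (t ^ j) * (ρ (t ^ (b : ℕ)) * E) = ρ (t ^ ((b : ℕ) + j)) * E := by
      rw [← Matrix.mul_assoc, ← map_mul, ← pow_add, add_comm]
    have h3 : (η ^ (a : ℕ) * lam) • (F a * (ρ (t ^ ((b : ℕ) + j)) * E)) =
        (η ^ ((b : ℕ) + j) * lam) • (F a * (ρ (t ^ ((b : ℕ) + j)) * E)) := by
      have h4 := congrArg (· * (ρ (t ^ ((b : ℕ) + j)) * E)) h1
      simp only [Matrix.mul_assoc] at h4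
      rw [hXE] at h4
      simpa using h4.symm
    rw [Matrix.mul_assoc, h2]
    rw [← sub_eq_zero, ← sub_smul, smul_eq_zero] at h3
    refine h3.resolve_left fun h5 => hab ?_
    have h6 := mul_right_cancel₀ hlam0 (sub_eq_zero.1 h5)
    rw [pow_eq_pow_mod _ hη.pow_eq_one, pow_eq_pow_mod ((b : ℕ) + j) hη.pow_eq_one] at h6
    exact hη.pow_inj (Nat.mod_lt _ hp.pos) (Nat.mod_lt _ hp.pos) h6

end CliffordDecomposition

/-! ### From the transforms of the cosets to the transform of the group -/

section Step

open Matrix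

/-- The value of a matrix representation at an element of the group algebra. -/
noncomputable def fourierMatrix {G : Type*} [Group G] [Fintype G] {d : ℕ}
    (ρ : G →* Matrix (Fin d) (Fin d) ℂ) (c : G → ℂ) : Matrix (Fin d) (Fin d) ℂ :=
  ∑ g, c g • ρ g

theorem mul_fourierMatrix_mul {G : Type*} [Group G] [Fintype G] {d e : ℕ}
    {ρ : G →* Matrix (Fin d) (Fin d) ℂ} {σ : G →* Matrix (Fin e) (Fin e) ℂ}
    {P : Matrix (Fin d) (Fin e) ℂ} {Q : Matrix (Fin e) (Fin d) ℂ}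
    (h : ∀ g, ρ g = P * σ g * Q) (c : G → ℂ) :
    fourierMatrix ρ c = P * fourierMatrix σ c * Q := by
  simp only [fourierMatrix, Matrix.mul_sum, Matrix.sum_mul, h, Matrix.mul_smul, Matrix.smul_mul]

theorem dim_eq_of_equiv {G : Type*} [Group G] {d e : ℕ} {ρ : G →* Matrix (Fin d) (Fin d) ℂ}
    {σ : G →* Matrix (Fin e) (Fin e) ℂ} (f : (matRep ρ).Equiv (matRep σ)) : d = e := by
  simpa using f.toLinearEquiv.finrank_eq

variable {G : Type*} [Group G] {p : ℕ} {χ : G →* ℂˣ} {t : G}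

/-- Grouping the elements of the group by the cosets of the kernel. -/
theorem fourierMatrix_eq_sum [Fintype G] [Fintype χ.ker] (hχ : ∀ g, χ g ^ p = 1)
    (ht : IsPrimitiveRoot (χ t) p) [NeZero p] {d : ℕ} (ρ : G →* Matrix (Fin d) (Fin d) ℂ) (c : G → ℂ) :
    fourierMatrix ρ c = ∑ l : Fin p,
      fourierMatrix (ρ.comp χ.ker.subtype) (fun h => c (h * t ^ (l : ℕ))) * ρ (t ^ (l : ℕ)) := by
  rw [fourierMatrix, ← (bijective_mul_pow hχ ht).sum_comp, Fintype.sum_prod_type, Finset.sum_comm]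
  refine Finset.sum_congr rfl fun l _ => ?_
  rw [fourierMatrix, Matrix.sum_mul]
  refine Finset.sum_congr rfl fun h _ => ?_
  rw [map_mul, Matrix.smul_mul]
  rfl

variable {J : CompleteIrreps χ.ker}

/-- Index of the Fourier coefficients on the `p` cosets of a subgroup `H`: a coset, a representation
of `H` and a matrix entry. -/
abbrev CosetIndex (p : ℕ) {H : Type*} [Group H] (J : CompleteIrreps H) : Type :=
  Fin p × (Σ j : Fin J.num, Fin (J.dim j) × Fin (J.dim j))

/-- The Fourier coefficients on all cosets of the kernel, each coset being shifted to the kernel by a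
power of `t`. -/
noncomputable def cosetDft [Fintype χ.ker] (J : CompleteIrreps χ.ker) (p : ℕ) (t : G) (c : G → ℂ) :
    CosetIndex p J → ℂ :=
  fun q => J.dft (fun h => c (h * t ^ (q.1 : ℕ))) q.2

theorem computableWith_cosetDft [Fintype χ.ker] {s : ℕ} (hJ : ComputableWith J.dft s) :
    ComputableWith (cosetDft J p t) (p * s) := by
  have h := ComputableWith.prod fun l : Fin p =>
    hJ.precomp fun h : χ.ker => (h : G) * t ^ (l : ℕ)
  simp only [Finset.sum_const, Finset.card_univ, Fintype.card_fin, smul_eq_mul] at h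
  exact h

/-- The matrix of coset `l` and representation `j` among the intermediate results. -/
def cosetBlock (y : CosetIndex p J → ℂ) (l : Fin p) (j : Fin J.num) :
    Matrix (Fin (J.dim j)) (Fin (J.dim j)) ℂ :=
  Matrix.of fun u v => y (l, ⟨j, (u, v)⟩)

theorem cosetBlock_cosetDft [Fintype χ.ker] (c : G → ℂ) (l : Fin p) (j : Fin J.num) :
    cosetBlock (cosetDft J p t c) l j =
      fourierMatrix (J.rep j) fun h => c (h * t ^ (l : ℕ)) := rfl

theorem computableWith_cosetBlock (l : Fin p) (j : Fin J.num) :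
    ComputableWith (fun (y : CosetIndex p J → ℂ) (q : Fin (J.dim j) × Fin (J.dim j)) =>
      cosetBlock y l j q.1 q.2) 0 :=
  ComputableWith.proj fun q => ((l, ⟨j, q⟩) : CosetIndex p J)

/-- Index of the Fourier coefficients of the `p` extensions of each representation of a subgroup `H`:
a representation of `H`, one of its extensions and a matrix entry. -/
abbrev ExtensionIndex (p : ℕ) {H : Type*} [Group H] (J : CompleteIrreps H) : Type :=
  Σ j : Fin J.num, Fin p × (Fin (J.dim j) × Fin (J.dim j))

/-- The Fourier coefficients of the `p` extensions of each representation of the kernel; `U j l` is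
the value at `t ^ l` of one extension of the representation `j`, and the others are its twists. -/
noncomputable def extensionDft (J : CompleteIrreps χ.ker) (w : ℂ)
    (U : ∀ j, Fin p → Matrix (Fin (J.dim j)) (Fin (J.dim j)) ℂ) (y : CosetIndex p J → ℂ) :
    ExtensionIndex p J → ℂ :=
  fun q => ∑ l : Fin p, w ^ ((q.2.1 : ℕ) * l) * (cosetBlock y l q.1 * U q.1 l) q.2.2.1 q.2.2.2

theorem computableWith_extensionDft {μ : ℕ → ℕ}
    (hμ : ∀ n, 1 ≤ n → ComputableWith (matMul n) (μ n)) {f : ℕ} {w : ℂ}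
    (hf : ComputableWith
      (fun (x : Fin p → ℂ) (k : Fin p) => ∑ l : Fin p, w ^ ((k : ℕ) * l) * x l) f)
    (U : ∀ j, Fin p → Matrix (Fin (J.dim j)) (Fin (J.dim j)) ℂ) :
    ComputableWith (extensionDft J w U) (∑ j, (p * μ (J.dim j) + J.dim j ^ 2 * f)) := by
  have hj : ∀ j, ComputableWith (fun (y : CosetIndex p J → ℂ)
      (q : Fin p × (Fin (J.dim j) × Fin (J.dim j))) =>
        ∑ l : Fin p, w ^ ((q.1 : ℕ) * l) * (cosetBlock y l j * U j l) q.2.1 q.2.2)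
      (p * μ (J.dim j) + J.dim j ^ 2 * f) := by
    intro j
    have h1 := ComputableWith.prod fun l : Fin p =>
      ComputableWith.mul_const (hμ _ (J.dim_pos j)) (by simp) (by simp) (by simp)
        (computableWith_cosetBlock (J := J) l j) (U j l)
    have h2 := (ComputableWith.prod fun q : Fin (J.dim j) × Fin (J.dim j) =>
      hf.precomp fun l : Fin p => (l, q)).select
        fun q : Fin p × (Fin (J.dim j) × Fin (J.dim j)) => (q.2, q.1)
    have h3 := h1.comp h2
    simp only [Finset.sum_const, Finset.card_univ, Fintype.card_fin, Fintype.card_prod,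
      smul_eq_mul, zero_add, ← sq] at h3
    exact h3
  exact ComputableWith.sigma hj

/-- A representation of the whole group that remains irreducible on the kernel is, up to the choice
of a basis, one of the `p` extensions of a representation of the kernel. -/
theorem exists_computableWith_of_irreducible [Fintype G] [Fintype χ.ker]
    (hχ : ∀ g, χ g ^ p = 1)
    (ht : IsPrimitiveRoot (χ t) p) [NeZero p]
    {U : ∀ j, Fin p → Matrix (Fin (J.dim j)) (Fin (J.dim j)) ℂ}
    (hU : ∀ j, (∃ S : G →* Matrix (Fin (J.dim j)) (Fin (J.dim j)) ℂ,
      ∀ h : χ.ker, S h = J.rep j h) → ∃ S : G →* Matrix (Fin (J.dim j)) (Fin (J.dim j)) ℂ,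
        (∀ h : χ.ker, S h = J.rep j h) ∧ ∀ l : Fin p, U j l = S (t ^ (l : ℕ)))
    {D r : ℕ} (hr : ComputableWith (matMul D) r) {ρ : G →* Matrix (Fin D) (Fin D) ℂ}
    (hres : (matRep (ρ.comp χ.ker.subtype)).IsIrreducible) :
    ∃ R : (CosetIndex p J ⊕ ExtensionIndex p J → ℂ) → Matrix (Fin D) (Fin D) ℂ,
      ComputableWith (fun x (q : Fin D × Fin D) => R x q.1 q.2) (2 * r) ∧
      ∀ c, R (Sum.elim (cosetDft J p t c) (extensionDft J (χ t : ℂ) U (cosetDft J p t c))) =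
        fourierMatrix ρ c := by
  obtain ⟨j, ⟨f⟩⟩ := J.complete D _ hres
  have hdim : D = J.dim j := dim_eq_of_equiv f
  obtain ⟨P, Q, hPQ, hQP, hρ⟩ := exists_matrix_of_equiv f
  -- Transporting `ρ` to the basis of `J` gives an extension of `J.rep j`.
  obtain ⟨ρ', hρ'⟩ : ∃ ρ' : G →* Matrix (Fin (J.dim j)) (Fin (J.dim j)) ℂ,
      ∀ g, ρ' g = Q * ρ g * P := by
    refine ⟨⟨⟨fun g => Q * ρ g * P, ?_⟩, fun g g' => ?_⟩, fun _ => rfl⟩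
    · rw [map_one, Matrix.mul_one, hQP]
    · simp only
      rw [map_mul, Matrix.mul_assoc (Q * ρ g), ← Matrix.mul_assoc P, ← Matrix.mul_assoc P, hPQ,
        Matrix.one_mul]
      simp only [Matrix.mul_assoc]
  have hρ'J : ∀ h : χ.ker, ρ' h = J.rep j h := by
    intro h
    have := hρ h
    simp only [MonoidHom.comp_apply, Subgroup.coe_subtype] at this
    rw [hρ', this]
    simp only [Matrix.mul_assoc, hQP, Matrix.mul_one]
    rw [← Matrix.mul_assoc, hQP, Matrix.one_mul]
  have hρρ' : ∀ g, ρ g = P * ρ' g * Q := by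
    intro g
    rw [hρ', Matrix.mul_assoc Q, ← Matrix.mul_assoc P, hPQ, Matrix.one_mul, Matrix.mul_assoc, hPQ,
      Matrix.mul_one]
  obtain ⟨S, hS, hUS⟩ := hU j ⟨ρ', hρ'J⟩
  obtain ⟨k, hk, hkt⟩ := exists_eq_smul_of_extension hχ ht (J.irreducible j) hρ'J hS
  let Z : (CosetIndex p J ⊕ ExtensionIndex p J → ℂ) → Matrix (Fin (J.dim j)) (Fin (J.dim j)) ℂ :=
    fun x => Matrix.of fun u v => x (Sum.inr ⟨j, (⟨k, hk⟩, (u, v))⟩)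
  have hZ : ComputableWith (fun x (q : Fin (J.dim j) × Fin (J.dim j)) => Z x q.1 q.2) 0 :=
    ComputableWith.proj _
  have h1 := ComputableWith.const_mul hr (by simp) (by simp [hdim]) (by simp [hdim]) hZ P
  have h2 := ComputableWith.mul_const hr (by simp) (by simp [hdim]) (by simp) h1 Q
  refine ⟨fun x => P * Z x * Q, by simpa [two_mul] using h2, fun c => ?_⟩
  have hZc : Z (Sum.elim (cosetDft J p t c) (extensionDft J (χ t : ℂ) U (cosetDft J p t c))) =
      ∑ l : Fin p, (χ t : ℂ) ^ (k * (l : ℕ)) • (cosetBlock (cosetDft J p t c) l j * U j l) := by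
    ext u v
    simp only [Z, Matrix.of_apply, Sum.elim_inr, extensionDft, Matrix.sum_apply,
      Matrix.smul_apply, smul_eq_mul]
  simp only
  rw [mul_fourierMatrix_mul hρρ', fourierMatrix_eq_sum hχ ht ρ', hZc]
  refine congrArg (fun A => P * A * Q) (Finset.sum_congr rfl fun l _ => ?_)
  have h3 : ρ' (t ^ (l : ℕ)) = (χ t : ℂ) ^ (k * (l : ℕ)) • U j l := by
    rw [hUS, map_pow, map_pow, hkt, smul_pow, pow_mul]
  have h4 : ρ'.comp χ.ker.subtype = J.rep j := MonoidHom.ext hρ'J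
  rw [h3, h4, cosetBlock_cosetDft, Matrix.mul_smul]

/-- A representation of the whole group that becomes reducible on the kernel consists of `p ^ 2`
blocks, up to the choice of a basis, and each of them is obtained from one matrix computed for one
coset of the kernel. -/
theorem exists_computableWith_of_not_irreducible [Fintype G] [Fintype χ.ker] (hp : p.Prime)
    (hχ : ∀ g, χ g ^ p = 1)
    (ht : IsPrimitiveRoot (χ t) p) {μ : ℕ → ℕ}
    (hμ : ∀ n, 1 ≤ n → ComputableWith (matMul n) (μ n)) {D : ℕ}
    {ρ : G →* Matrix (Fin D) (Fin D) ℂ} (hρ : (matRep ρ).IsIrreducible)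
    (hres : ¬ (matRep (ρ.comp χ.ker.subtype)).IsIrreducible) :
    ∃ d, 1 ≤ d ∧ p * d = D ∧ ∃ R : (CosetIndex p J → ℂ) → Matrix (Fin D) (Fin D) ℂ,
      ComputableWith (fun y (q : Fin D × Fin D) => R y q.1 q.2)
        (p * p * (2 * μ d) + 2 * μ D) ∧
      ∀ c, R (cosetDft J p t c) = fourierMatrix ρ c := by
  have : NeZero p := ⟨hp.ne_zero⟩
  obtain ⟨d, σ, E, F, hdim, hσ, hEF, hFσ, hzero⟩ := exists_block_decomposition hp hχ ht hρ hres
  have hd : 1 ≤ d := ((matRep_isIrreducible_iff _).1 (hσ 0)).1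
  have hD : 1 ≤ D := ((matRep_isIrreducible_iff _).1 hρ).1
  choose i hi using fun a => J.complete d (σ a) (hσ a)
  have hdi : ∀ a, d = J.dim (i a) := fun a => dim_eq_of_equiv (hi a).some
  choose P Q hPQ hQP hσJ using fun a => exists_matrix_of_equiv (hi a).some
  -- The coset that contributes to the block `(a, b)`.
  let l : Fin p → Fin p → Fin p := fun a b => ⟨(a + (p - b)) % p, Nat.mod_lt _ hp.pos⟩
  have hl : ∀ a b m : Fin p, m ≠ l a b → ¬ (a : ℕ) ≡ b + m [MOD p] := by
    intro a b m hm hmod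
    refine hm (Fin.ext ?_)
    have h1 : (b : ℕ) + m ≡ b + (l a b : ℕ) [MOD p] := by
      refine hmod.symm.trans ?_
      have h2 : (b : ℕ) + (a + (p - b)) = a + p := by have := b.isLt; omega
      have h3 : (b : ℕ) + (l a b : ℕ) ≡ b + (a + (p - b)) [MOD p] :=
        Nat.ModEq.add_left _ (Nat.mod_modEq _ _)
      rw [h2] at h3
      exact (h3.trans (by simp [Nat.ModEq])).symm
    exact (Nat.ModEq.add_left_cancel' _ h1).eq_of_lt_of_lt m.isLt (l a b).isLt
  let Blk : (CosetIndex p J → ℂ) → Fin p × Fin p → Matrix (Fin d) (Fin d) ℂ := fun y q =>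
    P q.1 * cosetBlock y (l q.1 q.2) (i q.1) *
      (Q q.1 * (F q.1 * ρ (t ^ (l q.1 q.2 : ℕ)) * E q.2))
  have hBlk : ComputableWith (fun y (q : (Fin p × Fin p) × (Fin d × Fin d)) =>
      Blk y q.1 q.2.1 q.2.2) (p * p * (2 * μ d)) := by
    have h := ComputableWith.prod fun q : Fin p × Fin p =>
      ComputableWith.mul_const (hμ d hd) (by simp) (by simp [← hdi]) (by simp)
        (ComputableWith.const_mul (hμ d hd) (by simp) (by simp [← hdi]) (by simp [← hdi])
          (computableWith_cosetBlock (J := J) (l q.1 q.2) (i q.1)) (P q.1))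
        (Q q.1 * (F q.1 * ρ (t ^ (l q.1 q.2 : ℕ)) * E q.2))
    simp only [Finset.sum_const, Finset.card_univ, Fintype.card_fin, Fintype.card_prod,
      smul_eq_mul, zero_add, ← two_mul] at h
    exact h
  let E' : Matrix (Fin D) (Fin p × Fin d) ℂ := Matrix.of fun x q => E q.1 x q.2
  let F' : Matrix (Fin p × Fin d) (Fin D) ℂ := Matrix.of fun q x => F q.1 q.2 x
  let M : (CosetIndex p J → ℂ) → Matrix (Fin p × Fin d) (Fin p × Fin d) ℂ := fun y =>
    Matrix.of fun q r => Blk y (q.1, r.1) q.2 r.2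
  have hM : ComputableWith (fun y (q : (Fin p × Fin d) × (Fin p × Fin d)) => M y q.1 q.2)
      (p * p * (2 * μ d)) :=
    hBlk.select fun q : (Fin p × Fin d) × (Fin p × Fin d) =>
      ((q.1.1, q.2.1), (q.1.2, q.2.2))
  have h1 := ComputableWith.const_mul (hμ D hD) (by simp) (by simp [hdim]) (by simp [hdim]) hM E'
  have h2 := ComputableWith.mul_const (hμ D hD) (by simp) (by simp [hdim]) (by simp) h1 F'
  refine ⟨d, hd, hdim, fun y => E' * M y * F', by simpa [two_mul, add_assoc] using h2, fun c => ?_⟩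
  have hblocks : ∀ y, E' * M y * F' = ∑ a, ∑ b, E a * Blk y (a, b) * F b := by
    intro y
    ext x z
    simp only [Matrix.mul_apply, Matrix.sum_apply, E', F', M, Matrix.of_apply,
      Fintype.sum_prod_type, Finset.sum_mul]
    conv_rhs => rw [Finset.sum_comm]
    refine Finset.sum_congr rfl fun b _ => ?_
    rw [Finset.sum_comm]
  have hentry : ∀ a b, Blk (cosetDft J p t c) (a, b) = F a * fourierMatrix ρ c * E b := by
    intro a b
    have h3 : ∀ m : Fin p, F a * fourierMatrix (ρ.comp χ.ker.subtype)
        (fun h => c (h * t ^ (m : ℕ))) =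
          fourierMatrix (σ a) (fun h => c (h * t ^ (m : ℕ))) * F a := by
      intro m
      simp only [fourierMatrix, Matrix.mul_sum, Matrix.sum_mul, Matrix.mul_smul, Matrix.smul_mul,
        MonoidHom.comp_apply, Subgroup.coe_subtype, hFσ]
    rw [fourierMatrix_eq_sum hχ ht ρ, Matrix.mul_sum, Matrix.sum_mul,
      Finset.sum_eq_single (l a b)]
    · rw [← Matrix.mul_assoc (F a), h3, mul_fourierMatrix_mul (hσJ a)]
      simp only [Blk, cosetBlock_cosetDft, Matrix.mul_assoc]
    · intro m _ hm
      rw [← Matrix.mul_assoc (F a), h3, Matrix.mul_assoc, Matrix.mul_assoc, ← Matrix.mul_assoc (F a),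
        hzero a b m (hl a b m hm), Matrix.mul_zero]
    · simp
  simp only [hblocks, hentry]
  calc ∑ a, ∑ b, E a * (F a * fourierMatrix ρ c * E b) * F b
      = (∑ a, E a * F a) * fourierMatrix ρ c * ∑ b, E b * F b := by
        simp only [Matrix.sum_mul, Matrix.mul_sum, Matrix.mul_assoc]
        rw [Finset.sum_comm]
    _ = fourierMatrix ρ c := by rw [hEF, Matrix.one_mul, Matrix.mul_one]

end Step

/-! ### The cost of one step -/

section StepCost

variable {G : Type*} [Group G] [Fintype G] {p : ℕ} {χ : G →* ℂˣ} [Fintype χ.ker] {t : G}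

/-- Reducing the transform of the group to `p` transforms of the kernel of `χ`. -/
theorem exists_computableWith_dft (hp : p.Prime) (hχ : ∀ g, χ g ^ p = 1)
    (ht : IsPrimitiveRoot (χ t) p) {μ : ℕ → ℕ} {b α : ℝ} (hα : 2 ≤ α) (hb : 0 ≤ b)
    (hμ : ∀ n, 1 ≤ n → ComputableWith (matMul n) (μ n) ∧ (μ n : ℝ) ≤ b * (n : ℝ) ^ α)
    {f : ℕ} (hf : ComputableWith (fun (x : Fin p → ℂ) (k : Fin p) =>
      ∑ l : Fin p, (χ t : ℂ) ^ ((k : ℕ) * l) * x l) f)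
    {J : CompleteIrreps χ.ker} {s : ℕ} (hJ : ComputableWith J.dft s) (I : CompleteIrreps G) :
    ∃ s' : ℕ, ComputableWith I.dft s' ∧ (s' : ℝ) ≤ p * s +
      ∑ j, (p * (b * (J.dim j : ℝ) ^ α) + (J.dim j : ℝ) ^ 2 * f) +
      ∑ i, 4 * b * (I.dim i : ℝ) ^ α := by
  classical
  have : NeZero p := ⟨hp.ne_zero⟩
  let U : ∀ j, Fin p → Matrix (Fin (J.dim j)) (Fin (J.dim j)) ℂ := fun j l =>
    if h : ∃ S : G →* Matrix (Fin (J.dim j)) (Fin (J.dim j)) ℂ, ∀ h : χ.ker, S h = J.rep j h then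
      h.choose (t ^ (l : ℕ)) else 0
  have hU : ∀ j, (∃ S : G →* Matrix (Fin (J.dim j)) (Fin (J.dim j)) ℂ,
      ∀ h : χ.ker, S h = J.rep j h) → ∃ S : G →* Matrix (Fin (J.dim j)) (Fin (J.dim j)) ℂ,
        (∀ h : χ.ker, S h = J.rep j h) ∧ ∀ l : Fin p, U j l = S (t ^ (l : ℕ)) :=
    fun j h => ⟨h.choose, h.choose_spec, fun l => by simp only [U, dif_pos h]⟩
  have hI : ∀ i, ∃ (r : ℕ) (R : (CosetIndex p J ⊕ ExtensionIndex p J → ℂ) →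
      Matrix (Fin (I.dim i)) (Fin (I.dim i)) ℂ), (r : ℝ) ≤ 4 * b * (I.dim i : ℝ) ^ α ∧
      ComputableWith (fun x (q : Fin (I.dim i) × Fin (I.dim i)) => R x q.1 q.2) r ∧
      ∀ c, R (Sum.elim (cosetDft J p t c) (extensionDft J (χ t : ℂ) U (cosetDft J p t c))) =
        fourierMatrix (I.rep i) c := by
    intro i
    obtain ⟨hμD, hμD'⟩ := hμ _ (I.dim_pos i)
    have h0 : 0 ≤ b * (I.dim i : ℝ) ^ α := by positivity
    by_cases hres : (matRep ((I.rep i).comp χ.ker.subtype)).IsIrreducible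
    · obtain ⟨R, h1, h2⟩ := exists_computableWith_of_irreducible hχ ht hU hμD hres
      exact ⟨_, R, by push_cast; linarith, h1, h2⟩
    · obtain ⟨d, hd, hdim, R, h1, h2⟩ := exists_computableWith_of_not_irreducible (J := J) hp hχ ht
        (fun n hn => (hμ n hn).1) (I.irreducible i) hres
      refine ⟨_, fun x => R fun q => x (Sum.inl q), ?_, h1.precomp Sum.inl, fun c => h2 c⟩
      have h3 : (p : ℝ) ^ 2 * (d : ℝ) ^ α ≤ (I.dim i : ℝ) ^ α := by
        rw [← hdim, Nat.cast_mul, Real.mul_rpow (by positivity) (by positivity)]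
        refine mul_le_mul_of_nonneg_right ?_ (by positivity)
        rw [← Real.rpow_two]
        exact Real.rpow_le_rpow_of_exponent_le (by exact_mod_cast hp.one_le) hα
      have h4 : (p : ℝ) * p * (2 * μ d) ≤ 2 * (b * (I.dim i : ℝ) ^ α) := by
        calc (p : ℝ) * p * (2 * μ d) ≤ p * p * (2 * (b * (d : ℝ) ^ α)) := by
              gcongr; exact (hμ d hd).2
          _ = 2 * (b * ((p : ℝ) ^ 2 * (d : ℝ) ^ α)) := by ring
          _ ≤ _ := by gcongr
      push_cast
      linarith
  choose r R hr hR hRc using hI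
  have h1 := (computableWith_cosetDft (p := p) (t := t) hJ).comp
    ((computableWith_extensionDft (fun n hn => (hμ n hn).1) hf U).keep.comp
      (ComputableWith.sigma hR))
  have hdft : I.dft = fun c q => R q.1 (Sum.elim (cosetDft J p t c)
      (extensionDft J (χ t : ℂ) U (cosetDft J p t c))) q.2.1 q.2.2 := by
    ext c q
    simp only [hRc]
    rfl
  refine ⟨_, hdft ▸ h1, ?_⟩
  push_cast
  rw [← add_assoc]
  gcongr with j hj i hi
  · exact (hμ _ (J.dim_pos j)).2
  · exact hr i

end StepCost

/-! ### Solvable groups -/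

/-- A nontrivial finite solvable group has a character of prime order. -/
theorem exists_character_of_prime_order {G : Type*} [Group G] [Finite G] [Nontrivial G]
    (hG : Group.IsSolvable G) :
    ∃ (p : ℕ) (χ : G →* ℂˣ) (t : G), p.Prime ∧ (∀ g, χ g ^ p = 1) ∧ IsPrimitiveRoot (χ t) p := by
  obtain ⟨a, ha⟩ : ∃ a : G, a ∉ commutator G := by
    by_contra! h
    exact (Group.IsSolvable.commutator_lt_top_of_nontrivial G).ne (eq_top_iff.2 fun g _ => h g)
  have ha' : Abelianization.of a ≠ 1 := fun h => ha ((QuotientGroup.eq_one_iff a).1 h)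
  have : Finite (Abelianization G) := Quotient.finite _
  obtain ⟨φ, hφ⟩ := CommGroup.exists_apply_ne_one_of_hasEnoughRootsOfUnity (Abelianization G) ℂ ha'
  let ψ : G →* ℂˣ := φ.comp Abelianization.of
  have hψ : ψ ≠ 1 := fun h => hφ (DFunLike.congr_fun h a)
  have hfin : IsOfFinOrder ψ := isOfFinOrder_iff_pow_eq_one.2 ⟨Nat.card G, Nat.card_pos, by
    ext g
    simp [← map_pow]⟩
  -- A suitable power of a nontrivial character has prime order.
  obtain ⟨p, hp, hdvd⟩ := Nat.exists_prime_and_dvd (n := orderOf ψ)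
    fun h => hψ (orderOf_eq_one_iff.1 h)
  obtain ⟨k, hk⟩ := hdvd
  have hpos := hfin.orderOf_pos
  have hk0 : k ≠ 0 := by rintro rfl; rw [hk, mul_zero] at hpos; exact lt_irrefl _ hpos
  have hklt : k < orderOf ψ := by
    rw [hk]; exact lt_mul_of_one_lt_left (Nat.pos_of_ne_zero hk0) hp.one_lt
  have hχ : ∀ g, (ψ ^ k) g ^ p = 1 := fun g => by
    rw [← MonoidHom.pow_apply, ← pow_mul, mul_comm, ← hk, pow_orderOf_eq_one]; rfl
  obtain ⟨t, ht⟩ : ∃ t, (ψ ^ k) t ≠ 1 := by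
    by_contra! h
    exact pow_ne_one_of_lt_orderOf hk0 hklt (MonoidHom.ext h)
  have := Fact.mk hp
  exact ⟨p, ψ ^ k, t, hp, hχ, IsPrimitiveRoot.iff_orderOf.2 (orderOf_eq_prime (hχ t) ht)⟩

/-- With `d` ranging over the dimensions of the irreducible representations of a group of order `N`,
this bounds the cost of one matrix multiplication for each of them. -/
theorem sum_rpow_le {ι : Type*} (s : Finset ι) (d : ι → ℕ) {N : ℕ} {γ : ℝ} (hγ : 1 < γ)
    (h : ∑ i ∈ s, d i ^ 2 ≤ N) : ∑ i ∈ s, (d i : ℝ) ^ (2 * γ) ≤ (N : ℝ) ^ γ := by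
  have h1 : ∀ i ∈ s, (d i : ℝ) ^ (2 * γ) ≤ (d i : ℝ) ^ 2 * (N : ℝ) ^ (γ - 1) := by
    intro i hi
    have h2 : ((d i : ℝ) ^ 2) ≤ N := by
      exact_mod_cast (Finset.single_le_sum (f := fun i => d i ^ 2) (fun _ _ => Nat.zero_le _)
        hi).trans h
    rw [Real.rpow_mul (by positivity), Real.rpow_two]
    calc ((d i : ℝ) ^ 2) ^ γ = ((d i : ℝ) ^ 2) ^ (1 + (γ - 1)) := by ring_nf
      _ = (d i : ℝ) ^ 2 * ((d i : ℝ) ^ 2) ^ (γ - 1) := by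
        rw [Real.rpow_add' (by positivity) (by linarith), Real.rpow_one]
      _ ≤ _ := by
        refine mul_le_mul_of_nonneg_left ?_ (by positivity)
        exact Real.rpow_le_rpow (by positivity) h2 (by linarith)
  calc _ ≤ ∑ i ∈ s, (d i : ℝ) ^ 2 * (N : ℝ) ^ (γ - 1) := Finset.sum_le_sum h1
    _ = (∑ i ∈ s, (d i : ℝ) ^ 2) * (N : ℝ) ^ (γ - 1) := by rw [Finset.sum_mul]
    _ ≤ N * (N : ℝ) ^ (γ - 1) := by
      refine mul_le_mul_of_nonneg_right ?_ (by positivity)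
      exact_mod_cast h
    _ = (N : ℝ) ^ (1 + (γ - 1)) := by
      rw [Real.rpow_add' (by positivity) (by linarith), Real.rpow_one]
    _ = (N : ℝ) ^ γ := by ring_nf

theorem CompleteIrreps.computableWith_dft_of_subsingleton {G : Type*} [Group G] [Fintype G]
    [Subsingleton G] (I : CompleteIrreps G) : ComputableWith I.dft 2 := by
  have hG : Fintype.card G = 1 := Fintype.card_eq_one_iff.2 ⟨1, fun g => Subsingleton.elim _ _⟩
  have h := ComputableWith.linear fun (q : Σ i : Fin I.num, Fin (I.dim i) × Fin (I.dim i))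
    (g : G) => I.rep q.1 g q.2.1 q.2.2
  have hcard : Fintype.card (Σ i : Fin I.num, Fin (I.dim i) × Fin (I.dim i)) ≤ 1 := by
    have := I.sum_sq_dim_le
    rw [hG] at this
    simpa [Fintype.card_sigma, sq] using this
  have h' := h.mono (t := 2) (by rw [hG]; omega)
  convert h' using 1
  ext c q
  simp [CompleteIrreps.dft, Matrix.sum_apply, mul_comm]

universe u

/-- The recursion `T(G) ≤ p * T(H) + B * |G| ^ γ` along a chain of normal subgroups of prime index
is solved by `T(G) = O(|G| ^ γ)`, since `p * |H| ^ γ ≤ 2 ^ (1 - γ) * |G| ^ γ`. -/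
theorem exists_dft_cost {γ : ℝ} (hγ : 1 < γ) (hω : matMulExponent < 2 * γ) :
    ∃ A : ℝ, ∀ (G : Type u) [Group G] [Fintype G], Group.IsSolvable G → ∀ I : CompleteIrreps G,
      ∃ s : ℕ, (s : ℝ) ≤ A * (Fintype.card G : ℝ) ^ γ ∧ ComputableWith I.dft s := by
  obtain ⟨b, hb, μ, hμ⟩ := exists_matMul_cost hω
  obtain ⟨K, hK, φ, hφ⟩ := exists_fourier_cost hγ
  obtain ⟨θ, hθ⟩ : ∃ θ : ℝ, θ = 2 ^ (1 - γ) := ⟨_, rfl⟩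
  have hθ1 : θ < 1 := hθ ▸ Real.rpow_lt_one_of_one_lt_of_neg (by norm_num) (by linarith)
  have hθ0 : 0 < θ := hθ ▸ by positivity
  obtain ⟨A, hA⟩ : ∃ A : ℝ, A = (5 * b + K + 2) / (1 - θ) := ⟨_, rfl⟩
  have hA1 : A * (1 - θ) = 5 * b + K + 2 := by
    rw [hA, div_mul_cancel₀ _ (by linarith)]
  have hA2 : 2 ≤ A := by
    rw [hA, le_div_iff₀ (by linarith)]; linarith
  refine ⟨A, ?_⟩
  suffices H : ∀ n : ℕ, ∀ (G : Type u) [Group G] [Fintype G], Fintype.card G = n →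
      Group.IsSolvable G → ∀ I : CompleteIrreps G,
        ∃ s : ℕ, (s : ℝ) ≤ A * (Fintype.card G : ℝ) ^ γ ∧ ComputableWith I.dft s from
    fun G _ _ hG I => H _ G rfl hG I
  intro n
  induction n using Nat.strong_induction_on with
  | _ n ih =>
  intro G _ _ hn hG I
  rcases subsingleton_or_nontrivial G with hsub | hnt
  · refine ⟨2, ?_, I.computableWith_dft_of_subsingleton⟩
    rw [Fintype.card_eq_one_iff.2 ⟨1, fun g => Subsingleton.elim _ _⟩]
    simpa using hA2
  obtain ⟨p, χ, t, hp, hχ, ht⟩ := exists_character_of_prime_order hG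
  have : NeZero p := ⟨hp.ne_zero⟩
  have := Fintype.ofFinite χ.ker
  have hcard : Fintype.card G = Fintype.card χ.ker * p := by
    simpa using (Fintype.card_of_bijective (bijective_mul_pow hχ ht)).symm
  obtain ⟨J⟩ := nonempty_completeIrreps χ.ker
  have hlt : Fintype.card χ.ker < n := by
    rw [← hn, hcard]; exact lt_mul_of_one_lt_right Fintype.card_pos hp.one_lt
  obtain ⟨s, hs, hJ⟩ := ih _ hlt χ.ker rfl inferInstance J
  obtain ⟨hφp, hf⟩ := hφ p hp.one_le
  obtain ⟨s', hI, hs'⟩ := exists_computableWith_dft hp hχ ht (by linarith) hb hμ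
    (hf (χ t : ℂ) (Units.ne_zero _)) hJ I
  refine ⟨s', hs'.trans ?_, hI⟩
  have hJsq := J.sum_sq_dim_le
  have hJα := sum_rpow_le Finset.univ J.dim hγ hJsq
  have hIα := sum_rpow_le Finset.univ I.dim hγ I.sum_sq_dim_le
  have hJsq' : ∑ j, (J.dim j : ℝ) ^ 2 ≤ Fintype.card χ.ker := by exact_mod_cast hJsq
  obtain ⟨N, hN⟩ : ∃ N : ℝ, N = (Fintype.card G : ℝ) ^ γ := ⟨_, rfl⟩
  obtain ⟨m, hm⟩ : ∃ m : ℝ, m = (Fintype.card χ.ker : ℝ) := ⟨_, rfl⟩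
  have hm1 : 1 ≤ m := by rw [hm]; exact_mod_cast Fintype.card_pos
  have hp2 : (2 : ℝ) ≤ p := by exact_mod_cast hp.two_le
  have hNm : N = m ^ γ * (p : ℝ) ^ γ := by
    rw [hN, hcard, hm, Nat.cast_mul, Real.mul_rpow (by positivity) (by positivity)]
  rw [← hm] at hs hJα hJsq'
  rw [← hN] at hIα ⊢
  have hN0 : 0 ≤ N := by rw [hN]; positivity
  have h1 : p * m ^ γ ≤ θ * N := by
    have h2 : (p : ℝ) ^ (1 - γ) ≤ θ :=
      hθ ▸ Real.rpow_le_rpow_of_nonpos (by norm_num) hp2 (by linarith)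
    have h3 : (p : ℝ) ^ (1 - γ) * (p : ℝ) ^ γ = p := by
      rw [← Real.rpow_add (by linarith)]; simp
    calc p * m ^ γ = (p : ℝ) ^ (1 - γ) * (p : ℝ) ^ γ * m ^ γ := by rw [h3]
      _ = (p : ℝ) ^ (1 - γ) * N := by rw [hNm]; ring
      _ ≤ θ * N := mul_le_mul_of_nonneg_right h2 hN0
  have h2 : m * (p : ℝ) ^ γ ≤ N := by
    rw [hNm]
    refine mul_le_mul_of_nonneg_right ?_ (by positivity)
    simpa using Real.rpow_le_rpow_of_exponent_le hm1 hγ.le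
  have hsum : ∑ j, (p * (b * (J.dim j : ℝ) ^ (2 * γ)) + (J.dim j : ℝ) ^ 2 * φ p) ≤
      b * N + K * N := by
    rw [Finset.sum_add_distrib, ← Finset.mul_sum, ← Finset.mul_sum, ← Finset.sum_mul]
    refine add_le_add ?_ ?_
    · calc (p : ℝ) * (b * ∑ j, (J.dim j : ℝ) ^ (2 * γ)) ≤ p * (b * m ^ γ) := by gcongr
        _ = b * (p * m ^ γ) := by ring
        _ ≤ b * (θ * N) := mul_le_mul_of_nonneg_left h1 hb
        _ ≤ b * N := mul_le_mul_of_nonneg_left (by nlinarith) hb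
    · calc (∑ j, (J.dim j : ℝ) ^ 2) * (φ p : ℝ) ≤ m * (K * (p : ℝ) ^ γ) := by gcongr
        _ = K * (m * (p : ℝ) ^ γ) := by ring
        _ ≤ K * N := mul_le_mul_of_nonneg_left h2 hK
  calc (p : ℝ) * s + _ + _ ≤ p * (A * m ^ γ) + (b * N + K * N) + 4 * b * N := by
        refine add_le_add (add_le_add (by gcongr) hsum) ?_
        rw [← Finset.mul_sum]
        gcongr
    _ = A * (p * m ^ γ) + (5 * b + K) * N := by ring
    _ ≤ A * (θ * N) + (5 * b + K) * N := by
        have := mul_le_mul_of_nonneg_left h1 (show (0 : ℝ) ≤ A by linarith)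
        linarith
    _ ≤ A * N := by
        have h3 : A * N - (A * (θ * N) + (5 * b + K) * N) = 2 * N := by
          have : A * N - A * (θ * N) = A * (1 - θ) * N := by ring
          rw [sub_add_eq_sub_sub, this, hA1]; ring
        linarith

theorem theorem4p4 :
    ∀ ε : ℝ, 0 < ε → ∃ c : ℝ, ∀ (G : Type*) [Group G] [Fintype G], Group.IsSolvable G →
      Nonempty (CompleteIrreps G) ∧
      ∀ I : CompleteIrreps G, ∃ s : ℕ,
        (s : ℝ) ≤ c * (Fintype.card G : ℝ) ^ (matMulExponent / 2 + ε) ∧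
          ComputableWith I.dft s := by
  intro ε hε
  have hω := two_le_matMulExponent
  obtain ⟨A, hA⟩ := exists_dft_cost (γ := matMulExponent / 2 + ε) (by linarith) (by linarith)
  exact ⟨A, fun G _ _ hG => ⟨nonempty_completeIrreps G, fun I => hA G hG I⟩⟩
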